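/- Let $(V,\omega)$ be a finite-dimensional real symplectic vector space, let $\Gamma$ be a compact Lie group with group homomorphisms $\sigma_1,\sigma_2:\Gamma\to\{\pm1\}$, acting continuously and linearly on $V$, and suppose that the action is $\sigma_1$-semisymplectic: $\omega(\gamma u,\gamma v)=\sigma_1(\gamma)\,\omega(u,v)$ for all $\gamma\in\Gamma$ and $u,v\in V$. Fix an inner product on $V$ for which $\Gamma$ acts orthogonally (one exists because $\Gamma$ is compact); transposes of linear maps and the norm $|\cdot|$ are taken with respect to it. For a differentiable $F:V\to\mathbb R$ let $X_F$ be its Hamiltonian vector field, $\omega(X_F(x),\cdot)=dF_x$. Let $H:V\to\mathbb R$ be a $C^\infty$ function with $H(0)=0$ whose Hamiltonian vector field $X=X_H$ satisfies $X(0)=0$ (equivalently $\nabla H(0)=0$) and is $\Gamma_{\sigma_2}$-equivariant: $X(\gamma x)=\sigma_2(\gamma)\,\gamma X(x)$ for all $\gamma,x$. Let $L=dX_0$, let $\mathbf S=\overline{\{e^{sL^T}:s\in\mathbb R\}}\subset GL(V)$, and suppose that $\mathbf S$ acts symplectically, i.e. $\omega(Au,Av)=\omega(u,v)$ for all $A\in\mathbf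 S$ and $u,v\in V$. Then $\Gamma$ normalizes $\mathbf S$, and the semidirect product $\mathbf S\rtimes\Gamma$ acts on $V$ by $(A,\gamma)x=A(\gamma x)$; put $\tilde\sigma_j(A,\gamma)=\sigma_j(\gamma)$. Let $\mathcal P^k$ be the space of homogeneous polynomial functions $V\to\mathbb R$ of degree $k$, $\mathcal P^k(\mathbf S)$ the subspace of $\mathbf S$-invariant ones, and $\mathcal P^k_{\tilde\sigma_1\tilde\sigma_2}(\mathbf S\rtimes\Gamma)$ the space of those $F\in\mathcal P^k$ with $F(A\gamma x)=\sigma_1(\gamma)\sigma_2(\gamma)F(x)$ for all $(A,\gamma)\in\mathbf S\rtimes\Gamma$ and $x\in V$. Let $H^2(x)=\tfrac12 d^2H_0(x,x)$, and let $ad^k_{H^2}(F)=\{F,H^2\}=\omega(X_F,X_{H^2})$ for $F\in\mathcal P^k$. Then for every $r\in\mathbb N$ there exist $K^k\in\mathcal P^k_{\tilde\sigma_1\tilde\sigma_2}(\mathbf S\rtimes\Gamma)$, $k=3,\dots,r$, such that, with $K=H^2+K^3+\cdots+K^r$: 1. $K$ is a normal form of $H$ up to order $r$ for the spaces $\mathcal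 D^k=\mathcal P^k(\mathbf S)$: $\mathcal P^k=ad^k_{H^2}(\mathcal P^k)\oplus\mathcal D^k$ and $K^k\in\mathcal D^k$ for $k=3,\dots,r$, and there is a $C^\infty$ symplectic diffeomorphism $\xi$ from an open neighbourhood of $0$ onto its image, with $\xi(0)=0$ and $d\xi_0=\mathrm{Id}$, such that $H(\xi(y))=K(y)+O(|y|^{r+1})$ as $y\to0$. 2. $X_K$ is a normal form of $X$ up to order $r-1$ for the same spaces $\mathcal D^k$: $X_K(y)=Ly+X_{K^3}(y)+\cdots+X_{K^r}(y)$, and there is a symplectic diffeomorphism $\xi$ as in 1 such that $(\xi^{-1})_*X(y)=X_K(y)+O(|y|^{r})$ as $y\to0$. In particular, $X$ is formally conjugate to a vector field of the form $X_K(y)+O(|y|^r)$. 3. $X_K$ keeps the symmetries and reversing symmetries of $X$: $X_K(\gamma y)=\sigma_2(\gamma)\,\gamma X_K(y)$ for all $\gamma\in\Gamma$ and $y\in V$. -/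

import Mathlib

open scoped Topology

noncomputable section

namespace HamNF

variable {V : Type*} [NormedAddCommGroup V] [InnerProductSpace ℝ V] [FiniteDimensional ℝ V]

/-- The general linear group of `V`. -/
abbrev GLin (V : Type*) [NormedAddCommGroup V] [InnerProductSpace ℝ V] : Type _ := (V →L[ℝ] V)ˣ

/-! ### Linear actions, characters with values in `{1, -1}`, symmetries -/

/-- `(ρ_g)^* ω = χ(g) ω` for all `g`. -/
def IsSemisymplectic (ω : LinearMap.BilinForm ℝ V) {G : Type*} [Group G]
    (ρ : G →* GLin V) (χ : G →* ℤˣ) : Prop :=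
  ∀ g u v, ω ((ρ g : V →L[ℝ] V) u) ((ρ g : V →L[ℝ] V) v) = χ g • ω u v

/-- The action is symplectic: it is semisymplectic for the trivial homomorphism. -/
def IsSymplecticAction (ω : LinearMap.BilinForm ℝ V) {G : Type*} [Group G]
    (ρ : G →* GLin V) : Prop :=
  IsSemisymplectic ω ρ 1

/-- The vector field `X` is `G_χ`-equivariant. -/
def IsEquivariant {G : Type*} [Group G] (ρ : G →* GLin V) (χ : G →* ℤˣ) (X : V → V) : Prop :=
  ∀ g x, X ((ρ g : V →L[ℝ] V) x) = χ g • (ρ g : V →L[ℝ] V) (X x)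

/-- The action is orthogonal for the inner product of `V`. -/
def IsOrthogonal {G : Type*} [Group G] (ρ : G →* GLin V) : Prop :=
  ∀ g x y, inner ℝ ((ρ g : V →L[ℝ] V) x) ((ρ g : V →L[ℝ] V) y) = inner ℝ x y

/-! ### Homogeneous polynomial functions -/

/-- `𝒫ᵏ`: the homogeneous polynomial functions `V → ℝ` of degree `k`. -/
def homPoly (V : Type*) [NormedAddCommGroup V] [InnerProductSpace ℝ V] (k : ℕ) :
    Submodule ℝ (V → ℝ) where
  carrier := {F | ∃ M : ContinuousMultilinearMap ℝ (fun _ : Fin k => V) ℝ,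
    ∀ x, F x = M (fun _ => x)}
  add_mem' := by
    rintro F G ⟨M, hM⟩ ⟨N, hN⟩
    exact ⟨M + N, fun x => by simp [hM, hN]⟩
  zero_mem' := ⟨0, fun x => by simp⟩
  smul_mem' := by
    rintro c F ⟨M, hM⟩
    exact ⟨c • M, fun x => by simp [hM]⟩

/-- `𝒫ᵏ_χ(G)`: the `F ∈ 𝒫ᵏ` with `F(g x) = χ(g) F(x)` for all `g ∈ G`, `x ∈ V`. -/
def homPolyInv {G : Type*} [Group G] (ρ : G →* GLin V) (χ : G →* ℤˣ) (k : ℕ) :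
    Submodule ℝ (V → ℝ) where
  carrier := {F | F ∈ homPoly V k ∧ ∀ g x, F ((ρ g : V →L[ℝ] V) x) = χ g • F x}
  add_mem' := by
    rintro F G ⟨hF, hF'⟩ ⟨hG, hG'⟩
    exact ⟨add_mem hF hG, fun g x => by simp [hF', hG', smul_add]⟩
  zero_mem' := ⟨zero_mem _, fun g x => by simp⟩
  smul_mem' := by
    rintro c F ⟨hF, hF'⟩
    exact ⟨Submodule.smul_mem _ c hF, fun g x => by
      rw [Pi.smul_apply, Pi.smul_apply, hF', smul_comm]⟩

theorem differentiable_of_mem_homPoly {V : Type*} [NormedAddCommGroup V] [InnerProductSpace ℝ V]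
    {k : ℕ} {F : V → ℝ} (hF : F ∈ homPoly V k) :
    Differentiable ℝ F := by
  obtain ⟨M, hM⟩ := hF
  have h : F = fun x => M (fun _ => x) := funext hM
  rw [h]
  have h1 : ContDiff ℝ 1 (fun x : V => M (fun _ => x)) :=
    M.contDiff.comp (contDiff_pi.2 fun _ => contDiff_id)
  exact h1.differentiable one_ne_zero

/-! ### Hamiltonian vector fields and Poisson brackets -/

/-- The `ω`-Hamiltonian vector field `X_H`, the one with `ω(X_H(x), ·) = dH_x`. -/
def hamVF (ω : LinearMap.BilinForm ℝ V) (hω : ω.Nondegenerate) (H : V → ℝ) (x : V) : V :=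
  (ω.toDual hω).symm (fderiv ℝ H x : V →ₗ[ℝ] ℝ)

/-- The defining property of the Hamiltonian vector field. -/
theorem hamVF_spec (ω : LinearMap.BilinForm ℝ V) (hω : ω.Nondegenerate) (H : V → ℝ) (x v : V) :
    ω (hamVF ω hω H x) v = fderiv ℝ H x v := by
  simp [hamVF]

/-- The Poisson bracket `{F, G}(x) = ω(X_F(x), X_G(x))`. -/
def poisson (ω : LinearMap.BilinForm ℝ V) (hω : ω.Nondegenerate) (F G : V → ℝ) (x : V) : ℝ :=
  ω (hamVF ω hω F x) (hamVF ω hω G x)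

/-- The linear operator `ad_Q^k : F ↦ {F, Q}` on `𝒫ᵏ`. -/
def adOp (ω : LinearMap.BilinForm ℝ V) (hω : ω.Nondegenerate) (Q : V → ℝ) (k : ℕ) :
    homPoly V k →ₗ[ℝ] (V → ℝ) where
  toFun F := poisson ω hω F Q
  map_add' F G := by
    funext x
    have hF := differentiable_of_mem_homPoly F.2 x
    have hG := differentiable_of_mem_homPoly G.2 x
    simp [poisson, hamVF_spec, fderiv_add hF hG]
  map_smul' c F := by
    funext x
    have hF := differentiable_of_mem_homPoly F.2 x
    simp [poisson, hamVF_spec, fderiv_const_smul hF c]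

/-- The quadratic form `H²` of the Hessian: `H²(x) = ½ d²H₀(x, x)`. -/
def quadPart (H : V → ℝ) (x : V) : ℝ :=
  (1 / 2 : ℝ) * fderiv ℝ (fderiv ℝ H) 0 x x

/-! ### The group `S` and the semidirect product `S ⋊ Γ` -/

/-- The one-parameter group `s ↦ exp (s Lᵀ)`, where `Lᵀ` is the adjoint of `L`. -/
def expTranspose (L : V →L[ℝ] V) : Multiplicative ℝ →* GLin V :=
  MonoidHom.toHomUnits
    { toFun := fun s => NormedSpace.exp (s.toAdd • ContinuousLinearMap.adjoint L)
      map_one' := by simp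
      map_mul' := fun s t => by
        rw [toAdd_mul, add_smul]
        let _ : NormedAlgebra ℚ (V →L[ℝ] V) := NormedAlgebra.restrictScalars ℚ ℝ _
        exact NormedSpace.exp_add_of_commute
          (((Commute.refl (ContinuousLinearMap.adjoint L)).smul_left _).smul_right _) }

/-- `S`, the closure of the group `{exp (s Lᵀ) : s ∈ ℝ}` in the general linear group. -/
def groupS (L : V →L[ℝ] V) : Subgroup (GLin V) :=
  (expTranspose L).range.topologicalClosure

/-- The linearization at the origin of a `Γ_σ`-equivariant vector field is `Γ_σ`-equivariant. -/
theorem linearization_comp {V : Type*} [NormedAddCommGroup V] [InnerProductSpace ℝ V]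
    {Γ : Type*} [Group Γ] {ρ : Γ →* GLin V} {σ : Γ →* ℤˣ}
    {X : V → V} (hX : IsEquivariant ρ σ X) (γ : Γ) :
    fderiv ℝ X 0 * (ρ γ : V →L[ℝ] V) = σ γ • ((ρ γ : V →L[ℝ] V) * fderiv ℝ X 0) := by
  let e : V ≃L[ℝ] V := ContinuousLinearEquiv.unitsEquiv ℝ V (ρ γ)
  have he : (e : V →L[ℝ] V) = (ρ γ : V →L[ℝ] V) := rfl
  have h1 : (X ∘ e) = fun x => σ γ • (e ∘ X) x := funext fun x => hX γ x
  have h2 : fderiv ℝ (X ∘ e) 0 = (fderiv ℝ X 0).comp (e : V →L[ℝ] V) := by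
    rw [e.comp_right_fderiv, map_zero]
  have h3 : fderiv ℝ (e ∘ X) 0 = (e : V →L[ℝ] V).comp (fderiv ℝ X 0) := e.comp_fderiv
  have h4 : fderiv ℝ (fun x => σ γ • (e ∘ X) x) 0 = σ γ • fderiv ℝ (e ∘ X) 0 := by
    rcases Int.units_eq_one_or (σ γ) with h | h
    · simp only [h, one_smul]
    · simp only [h, Units.neg_smul, one_smul]
      exact fderiv_fun_neg
  rw [← h1, h2, h3, he] at h4
  exact h4

/-- The transposed linearization of a `Γ_σ`-equivariant vector field is `Γ_σ`-equivariant, if `Γ`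
acts orthogonally. -/
theorem transpose_comp {Γ : Type*} [Group Γ] {ρ : Γ →* GLin V} {σ : Γ →* ℤˣ}
    (hρ : IsOrthogonal ρ) {X : V → V} (hX : IsEquivariant ρ σ X) (γ : Γ) :
    (ρ γ : V →L[ℝ] V) * ContinuousLinearMap.adjoint (fderiv ℝ X 0) *
      ((ρ γ)⁻¹ : GLin V) = σ γ • ContinuousLinearMap.adjoint (fderiv ℝ X 0) := by
  have hadj : ContinuousLinearMap.adjoint (ρ γ : V →L[ℝ] V) = ((ρ γ)⁻¹ : GLin V) := by
    have h : ContinuousLinearMap.adjoint (ρ γ : V →L[ℝ] V) * (ρ γ : V →L[ℝ] V) = 1 := by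
      refine ContinuousLinearMap.ext fun x => ext_inner_right ℝ fun y => ?_
      change inner ℝ (ContinuousLinearMap.adjoint (ρ γ : V →L[ℝ] V) ((ρ γ : V →L[ℝ] V) x)) y = _
      rw [ContinuousLinearMap.adjoint_inner_left]
      exact hρ γ x y
    exact (Units.inv_eq_of_mul_eq_one_left h).symm
  have hL := congrArg ContinuousLinearMap.adjoint (linearization_comp hX γ⁻¹)
  have hadj' : ContinuousLinearMap.adjoint ((ρ γ⁻¹ : GLin V) : V →L[ℝ] V) = ρ γ := by
    rw [map_inv, ← hadj, ContinuousLinearMap.adjoint_adjoint]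
  have hs : ∀ A : V →L[ℝ] V, ContinuousLinearMap.adjoint (σ γ⁻¹ • A) =
      σ γ • ContinuousLinearMap.adjoint A := by
    intro A
    rw [map_inv, Int.units_inv_eq_self]
    rcases Int.units_eq_one_or (σ γ) with h | h
    · simp [h]
    · simp [h, Units.neg_smul]
  rw [hs] at hL
  simp only [ContinuousLinearMap.mul_def, ContinuousLinearMap.adjoint_comp, hadj'] at hL
  simp only [← ContinuousLinearMap.mul_def] at hL
  rw [hL, smul_mul_assoc, mul_assoc, Units.mul_inv, mul_one]

/-- `Γ` normalizes `S`: `ρ_γ exp (s Lᵀ) ρ_γ⁻¹ = exp (σ(γ) s Lᵀ)`. -/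
theorem mem_normalizer_groupS {Γ : Type*} [Group Γ] {ρ : Γ →* GLin V} {σ : Γ →* ℤˣ}
    (hρ : IsOrthogonal ρ) {X : V → V} (hX : IsEquivariant ρ σ X) (γ : Γ) :
    ρ γ ∈ Subgroup.normalizer (groupS (fderiv ℝ X 0) : Set (GLin V)) := by
  set L := fderiv ℝ X 0 with hLdef
  have key : ∀ γ : Γ, ∀ A ∈ groupS L, ρ γ * A * (ρ γ)⁻¹ ∈ groupS L := by
    intro γ A hA
    have hc : Continuous fun B : GLin V => ρ γ * B * (ρ γ)⁻¹ :=
      (continuous_const.mul continuous_id).mul continuous_const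
    have hmaps : Set.MapsTo (fun B : GLin V => ρ γ * B * (ρ γ)⁻¹)
        ((expTranspose L).range : Set (GLin V)) ((expTranspose L).range : Set (GLin V)) := by
      rintro _ ⟨s, rfl⟩
      refine ⟨Multiplicative.ofAdd ((((σ γ : ℤˣ) : ℤ) : ℝ) * s.toAdd), Units.ext ?_⟩
      have h := transpose_comp hρ hX γ
      change NormedSpace.exp (((((σ γ : ℤˣ) : ℤ) : ℝ) * s.toAdd) •
        ContinuousLinearMap.adjoint L) = (ρ γ : V →L[ℝ] V) *
          NormedSpace.exp (s.toAdd • ContinuousLinearMap.adjoint L) * ((ρ γ)⁻¹ : GLin V)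
      let _ : NormedAlgebra ℚ (V →L[ℝ] V) := NormedAlgebra.restrictScalars ℚ ℝ _
      rw [← NormedSpace.exp_units_conj, mul_smul_comm, smul_mul_assoc, h, mul_comm, mul_smul,
        Units.smul_def, Int.cast_smul_eq_zsmul]
    exact map_mem_closure (f := fun B : GLin V => ρ γ * B * (ρ γ)⁻¹) hc hA hmaps
  rw [Subgroup.mem_normalizer_iff]
  intro A
  refine ⟨key γ A, fun h => ?_⟩
  have h' := key γ⁻¹ _ h
  simpa [map_inv, mul_assoc] using h'

/-- The action of `Γ` on `S` by conjugation, `φ_γ(A) = ρ_γ A ρ_γ⁻¹`. -/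
def conjS {Γ : Type*} [Group Γ] (ρ : Γ →* GLin V) (L : V →L[ℝ] V)
    (hN : ∀ γ, ρ γ ∈ Subgroup.normalizer (groupS L : Set (GLin V))) :
    Γ →* MulAut (groupS L) :=
  (groupS L).normalizerMonoidHom.comp (ρ.codRestrict _ hN)

/-- The semidirect product `S ⋊ Γ`. -/
abbrev SemiS {Γ : Type*} [Group Γ] (ρ : Γ →* GLin V) (L : V →L[ℝ] V)
    (hN : ∀ γ, ρ γ ∈ Subgroup.normalizer (groupS L : Set (GLin V))) : Type _ :=
  groupS L ⋊[conjS ρ L hN] Γ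

/-- The action of `S ⋊ Γ` on `V`: `(A, γ) x = A (γ x)`. -/
def semiAction {Γ : Type*} [Group Γ] (ρ : Γ →* GLin V) (L : V →L[ℝ] V)
    (hN : ∀ γ, ρ γ ∈ Subgroup.normalizer (groupS L : Set (GLin V))) :
    SemiS ρ L hN →* GLin V :=
  SemidirectProduct.lift (groupS L).subtype ρ (fun γ => by
    ext A : 1
    rfl)

/-- The homomorphism `σ̃ : S ⋊ Γ → {1, -1}`, `σ̃(A, γ) = σ(γ)`. -/
def tildeChar {Γ : Type*} [Group Γ] (ρ : Γ →* GLin V) (L : V →L[ℝ] V)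
    (hN : ∀ γ, ρ γ ∈ Subgroup.normalizer (groupS L : Set (GLin V))) (σ : Γ →* ℤˣ) :
    SemiS ρ L hN →* ℤˣ :=
  σ.comp SemidirectProduct.rightHom

/-! ### Normal forms -/

/-- `ξ` is a symplectic diffeomorphism of the open neighbourhood `U` of the origin onto its image,
with `ξ(0) = 0` and `dξ₀ = Id`. (Its derivative is invertible at each point of `U`, because it
preserves the non-degenerate form `ω`.) -/
structure IsSymplecticChange (ω : LinearMap.BilinForm ℝ V) (U : Set V) (ξ : V → V) : Prop where
  isOpen : IsOpen U
  zero_mem : (0 : V) ∈ U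
  smooth : ContDiffOn ℝ ((⊤ : ℕ∞) : WithTop ℕ∞) ξ U
  injOn : Set.InjOn ξ U
  map_zero : ξ 0 = 0
  fderiv_zero : fderiv ℝ ξ 0 = ContinuousLinearMap.id ℝ V
  symplectic : ∀ y ∈ U, ∀ u v, ω (fderiv ℝ ξ y u) (fderiv ℝ ξ y v) = ω u v

/-- `𝒫ᵏ = ad_{H²}(𝒫ᵏ) ⊕ 𝒟`. -/
def IsComplementAd (ω : LinearMap.BilinForm ℝ V) (hω : ω.Nondegenerate) (H : V → ℝ) (k : ℕ)
    (D : Submodule ℝ (V → ℝ)) : Prop :=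
  LinearMap.range (adOp ω hω (quadPart H) k) ⊓ D = ⊥ ∧
    LinearMap.range (adOp ω hω (quadPart H) k) ⊔ D = homPoly V k

/-- `K` is a normal form of `H` up to order `r`, for the spaces `𝒟ᵏ`: each `𝒟ᵏ` is a complement
of `ad_{H²}(𝒫ᵏ)` in `𝒫ᵏ`, `K = H² + K³ + ⋯ + Kʳ` with `Kᵏ ∈ 𝒟ᵏ`, and a symplectic change of
coordinates transforms `H` into `K + O(|y|^{r+1})`. -/
def IsNormalForm (ω : LinearMap.BilinForm ℝ V) (hω : ω.Nondegenerate)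
    (D : ℕ → Submodule ℝ (V → ℝ)) (H : V → ℝ) (r : ℕ) (K : V → ℝ) : Prop :=
  (∀ k ∈ Finset.Icc 3 r, IsComplementAd ω hω H k (D k)) ∧
  (∃ P : ℕ → V → ℝ, (∀ k ∈ Finset.Icc 3 r, P k ∈ D k) ∧
    K = quadPart H + ∑ k ∈ Finset.Icc 3 r, P k) ∧
  ∃ U ξ, IsSymplecticChange ω U ξ ∧
    (fun y => H (ξ y) - K y) =O[𝓝 0] fun y => ‖y‖ ^ (r + 1)

/-- `Y` is a normal form up to order `r - 1` of the vector field `X = X_H`, for the spaces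
`𝒟ᵏ`: each `𝒟ᵏ` is a complement of `ad_{H²}(𝒫ᵏ)` in `𝒫ᵏ`,
`Y(y) = L y + X_{K³}(y) + ⋯ + X_{Kʳ}(y)` with `L = dX₀` and `Kᵏ ∈ 𝒟ᵏ`, and a symplectic change of
coordinates `ξ` transforms `X` into a vector field `Z = ξ⁻¹_* X` with `Z(y) = Y(y) + O(|y|^r)`.
(Taking Taylor series, `X` is formally conjugate to a vector field of the form `Y + O(|y|^r)`.) -/
def IsNormalFormVF (ω : LinearMap.BilinForm ℝ V) (hω : ω.Nondegenerate)
    (D : ℕ → Submodule ℝ (V → ℝ)) (H : V → ℝ) (X : V → V) (r : ℕ)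
    (Y : V → V) : Prop :=
  (∀ k ∈ Finset.Icc 3 r, IsComplementAd ω hω H k (D k)) ∧
  (∃ P : ℕ → V → ℝ, (∀ k ∈ Finset.Icc 3 r, P k ∈ D k) ∧
    Y = fun y => fderiv ℝ X 0 y + ∑ k ∈ Finset.Icc 3 r, hamVF ω hω (P k) y) ∧
  ∃ U ξ, IsSymplecticChange ω U ξ ∧ ∃ Z : V → V,
    (∀ y ∈ U, fderiv ℝ ξ y (Z y) = X (ξ y)) ∧
    (fun y => Z y - Y y) =O[𝓝 0] fun y => ‖y‖ ^ r

end HamNF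

end

noncomputable section

namespace HamNF

/-! ### Germs of smooth functions vanishing to a given order -/

section Germs

open Asymptotics Filter

variable {V : Type*} [NormedAddCommGroup V] [NormedSpace ℝ V]
  {G : Type*} [NormedAddCommGroup G] [NormedSpace ℝ G]

/-! The linear operator to invert in the normal form procedure is `ad_{H²}`. The Hamiltonian vector
field of `H²` is `L`, so `ad_{H²} F` is the Lie derivative `dF(L x)`. For the Fischer inner product
on `𝒫ᵏ`, in which pairing with `⟨x, ·⟩ᵏ` evaluates at `x`, the adjoint of the Lie derivative along
`L` is the Lie derivative along `Lᵀ` (`inner_lieDer_symTensor`). Hence `𝒫ᵏ` is the orthogonal sum of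
the range of `ad_{H²}` and the kernel of the Lie derivative along `Lᵀ`, and this kernel consists of
the `S`-invariants (`invariant_groupS_iff`).

The normal form is built degree by degree. If `H ∘ ξ` is normalized below degree `k`, its term of
degree `k` beyond the normal form is split as `P + dF(L x)`, and composition with a symplectic map
`η = id + X_F + O(|y|ᵏ)` changes `H²` by `-dF(L x)`, which removes the second summand. The map `η`
is not a time-one flow but one step of the implicit midpoint rule for `X_F`; it is symplectic for
the same reason as a Cayley transform (`exists_symplecticChange`).

Symmetry is carried along by uniqueness of the splitting, not by averaging. As `X` is
`σ₂`-equivariant and `H(0) = 0`, `H` is `σ₁σ₂`-semi-invariant. If `F` is chosen orthogonal to the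
kernel of `ad_{H²}`, then `P` and `F` are unique, so `P` is `σ₁σ₂`- and `F` is `σ₁`-semi-invariant
(`exists_equivariant_splitting`). Then `X_F` commutes with `Γ`, so does the germ of `η`, and the new
Hamiltonian is again semi-invariant.

The first section supplies the calculus of jets: for a smooth germ, `O(|y|ᵐ)` means that the
derivatives of order below `m` vanish at the origin. -/

theorem iteratedFDeriv_comp_swap_adjacent {n : ℕ} (i : Fin n) {f : V → G} {x : V}
    (hf : ContDiffAt ℝ (n + 1 : ℕ) f x) (v : Fin (n + 1) → V) :
    iteratedFDeriv ℝ (n + 1) f x (v ∘ Equiv.swap i.castSucc i.succ) =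
      iteratedFDeriv ℝ (n + 1) f x v := by
  induction n generalizing x with
  | zero => exact i.elim0
  | succ n ih =>
    refine Fin.cases ?_ (fun j => ?_) i
    -- A swap of the first two arguments is the symmetry of the second derivative of `Dⁿf`.
    · have hd : ContDiffAt ℝ 2 (iteratedFDeriv ℝ n f) x :=
        hf.iteratedFDeriv_right (by norm_cast; omega)
      have hs : IsSymmSndFDerivAt ℝ (iteratedFDeriv ℝ n f) x :=
        hd.isSymmSndFDerivAt (by simp)
      have key : ∀ w : Fin (n + 2) → V, iteratedFDeriv ℝ (n + 2) f x w =
          fderiv ℝ (fderiv ℝ (iteratedFDeriv ℝ n f)) x (w 0) (w 1) (Fin.tail (Fin.tail w)) := by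
        intro w
        have h1 : DifferentiableAt ℝ (iteratedFDeriv ℝ (n + 1) f) x :=
          hf.differentiableAt_iteratedFDeriv (by norm_cast; omega)
        have h2 : DifferentiableAt ℝ (fderiv ℝ (iteratedFDeriv ℝ n f)) x :=
          (hd.fderiv_right (m := 1) (by norm_num)).differentiableAt one_ne_zero
        rw [iteratedFDeriv_succ_apply_left,
          ← fderiv_continuousMultilinear_apply_const_apply h1]
        have h3 : (fun y => iteratedFDeriv ℝ (n + 1) f y (Fin.tail w)) =
            fun y => fderiv ℝ (iteratedFDeriv ℝ n f) y (w 1) (Fin.tail (Fin.tail w)) := by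
          funext y
          rw [iteratedFDeriv_succ_apply_left]
          rfl
        rw [h3, fderiv_continuousMultilinear_apply_const_apply
          (h2.clm_apply (differentiableAt_const _)),
          fderiv_clm_apply h2 (differentiableAt_const _)]
        simp
      rw [key, key, hs.eq]
      rfl
    -- A swap of later arguments does not touch the last differentiation: the symmetry of one order
    -- less holds near `x`, and it is differentiated.
    · have hev : ∀ᶠ y in 𝓝 x, ∀ w : Fin (n + 1) → V, ∀ i : Fin n,
          iteratedFDeriv ℝ (n + 1) f y (w ∘ Equiv.swap i.castSucc i.succ) =
            iteratedFDeriv ℝ (n + 1) f y w := by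
        have h1 : ContDiffAt ℝ (n + 1 : ℕ) f x := hf.of_le (by norm_cast; omega)
        filter_upwards [h1.eventually (by simp)] with y hy w i using ih i hy w
      have hd : DifferentiableAt ℝ (iteratedFDeriv ℝ (n + 1) f) x :=
        hf.differentiableAt_iteratedFDeriv (by norm_cast; omega)
      have key : ∀ (h : V) (u : Fin (n + 1) → V), fderiv ℝ (iteratedFDeriv ℝ (n + 1) f) x h u =
          fderiv ℝ (fun y => iteratedFDeriv ℝ (n + 1) f y u) x h := fun h u => by
        rw [fderiv_continuousMultilinear_apply_const_apply hd]
      rw [iteratedFDeriv_succ_apply_left, iteratedFDeriv_succ_apply_left, key, key]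
      have htail : Fin.tail (v ∘ Equiv.swap j.succ.castSucc j.succ.succ) =
          Fin.tail v ∘ Equiv.swap j.castSucc j.succ := by
        funext a
        change v (Equiv.swap j.castSucc.succ j.succ.succ a.succ) = v (Fin.succ _)
        rw [← (Fin.succ_injective _).map_swap]
      have h0 : (v ∘ Equiv.swap j.succ.castSucc j.succ.succ) 0 = v 0 := by
        change v (Equiv.swap j.castSucc.succ j.succ.succ 0) = v 0
        rw [Equiv.swap_apply_of_ne_of_ne (Fin.succ_ne_zero _).symm (Fin.succ_ne_zero _).symm]
      rw [htail, h0]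
      congr 1
      exact Filter.EventuallyEq.fderiv_eq (hev.mono fun y hy => hy _ j)

/-- The iterated derivative of order `n` of a function of class `C^n` is symmetric. -/
theorem iteratedFDeriv_comp_perm_of_contDiffAt {n : ℕ} {f : V → G} {x : V}
    (hf : ContDiffAt ℝ n f x) (v : Fin n → V) (τ : Equiv.Perm (Fin n)) :
    iteratedFDeriv ℝ n f x (v ∘ τ) = iteratedFDeriv ℝ n f x v := by
  rcases n with _ | n
  · exact congrArg _ (Subsingleton.elim _ _)
  have hτ : τ ∈ Submonoid.closure
      (Set.range fun i : Fin n => Equiv.swap i.castSucc i.succ) := by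
    rw [Equiv.Perm.mclosure_swap_castSucc_succ]; trivial
  induction hτ using Submonoid.closure_induction generalizing v with
  | mem τ hτ =>
    obtain ⟨i, rfl⟩ := hτ
    exact iteratedFDeriv_comp_swap_adjacent i hf v
  | one => rfl
  | mul a b _ _ ha hb =>
    rw [Equiv.Perm.coe_mul, ← Function.comp_assoc, hb, ha]

theorem isBigO_norm_pow_succ_of_fderiv {f : V → G} {m : ℕ}
    (hd : ∀ᶠ y in 𝓝 (0 : V), DifferentiableAt ℝ f y) (h0 : f 0 = 0)
    (h : fderiv ℝ f =O[𝓝 0] fun y : V => ‖y‖ ^ m) :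
    f =O[𝓝 0] fun y : V => ‖y‖ ^ (m + 1) := by
  obtain ⟨C, hC0, hC⟩ := h.exists_nonneg
  obtain ⟨ε, hε, hball⟩ := Metric.eventually_nhds_iff.1 (hd.and hC.bound)
  refine IsBigO.of_bound C (Metric.eventually_nhds_iff.2 ⟨ε, hε, fun y hy => ?_⟩)
  have hsub : ∀ z ∈ Metric.closedBall (0 : V) ‖y‖,
      DifferentiableAt ℝ f z ∧ ‖fderiv ℝ f z‖ ≤ C * ‖y‖ ^ m := by
    intro z hz
    rw [mem_closedBall_zero_iff] at hz
    have h1 := hball (y := z) (by rw [dist_zero_right] at hy ⊢; exact hz.trans_lt hy)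
    refine ⟨h1.1, h1.2.trans ?_⟩
    rw [norm_pow, norm_norm]
    gcongr
  have := (convex_closedBall (0 : V) ‖y‖).norm_image_sub_le_of_norm_fderiv_le
    (fun z hz => (hsub z hz).1) (fun z hz => (hsub z hz).2)
    (Metric.mem_closedBall_self (norm_nonneg y)) (mem_closedBall_zero_iff.2 le_rfl)
  rw [h0, sub_zero, sub_zero] at this
  rw [norm_pow, norm_norm, pow_succ, ← mul_assoc]
  exact this

/-- The derivative of order `m` is bounded near the origin, and each descent by one order gains a
power of `|y|` by the mean value inequality. -/
theorem iteratedFDeriv_isBigO_of_eq_zero {f : V → G} (hf : ContDiffAt ℝ (⊤ : ℕ∞) f 0) {m : ℕ}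
    (h : ∀ j < m, iteratedFDeriv ℝ j f 0 = 0) {i j : ℕ} (hij : i + j = m) :
    iteratedFDeriv ℝ i f =O[𝓝 0] fun y : V => ‖y‖ ^ j := by
  induction j generalizing i with
  | zero =>
    simp only [pow_zero]
    exact (hf.differentiableAt_iteratedFDeriv (by exact_mod_cast ENat.natCast_lt_top i)
      ).continuousAt.norm.isBoundedUnder_le.isBigO_one ℝ
  | succ j ih =>
    refine isBigO_norm_pow_succ_of_fderiv ?_ (h i (by omega)) ?_
    · have h1 : ContDiffAt ℝ (i + 1 : ℕ) f 0 := hf.of_le (by exact_mod_cast le_top)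
      filter_upwards [h1.eventually (by simp)] with y hy
      exact hy.differentiableAt_iteratedFDeriv (by norm_cast; omega)
    · refine ((ih (i := i + 1) (by omega)).norm_left.congr_left fun y => ?_).of_norm_left
      exact norm_fderiv_iteratedFDeriv.symm

theorem contDiff_diagonal {m : ℕ} (M : V [×m]→L[ℝ] G) {n : WithTop ℕ∞} :
    ContDiff ℝ n (fun x : V => M fun _ => x) :=
  M.contDiff.comp (contDiff_pi.2 fun _ => contDiff_id)

theorem diagonal_isBigO {m : ℕ} (M : V [×m]→L[ℝ] G) (l : Filter V) :
    (fun x : V => M fun _ => x) =O[l] fun y : V => ‖y‖ ^ m :=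
  IsBigO.of_bound ‖M‖ (Eventually.of_forall fun y => by
    simpa using M.le_opNorm fun _ => y)

/-- Along the ray `t x` the hypothesis reads `tᵐ |M(x, …, x)| ≤ C' tᵐ⁺¹`; divide by `tᵐ` and let `t`
tend to `0`. -/
theorem diagonal_eq_zero_of_isBigO {m : ℕ} {M : V [×m]→L[ℝ] G}
    (h : (fun x : V => M fun _ => x) =O[𝓝 0] fun y : V => ‖y‖ ^ (m + 1)) (x : V) :
    M (fun _ => x) = 0 := by
  obtain ⟨C, hC⟩ := h.bound
  have ht : Tendsto (fun t : ℝ => t • x) (𝓝[>] 0) (𝓝 0) := by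
    have : Tendsto (fun t : ℝ => t • x) (𝓝 0) (𝓝 ((0 : ℝ) • x)) :=
      (continuous_id.smul continuous_const).tendsto _
    rw [zero_smul] at this
    exact this.mono_left nhdsWithin_le_nhds
  have hb : ∀ᶠ t : ℝ in 𝓝[>] 0, ‖M (fun _ => x)‖ ≤ t * (C * ‖x‖ ^ (m + 1)) := by
    filter_upwards [ht.eventually hC, self_mem_nhdsWithin] with t h1 h2
    have h2 : 0 < t := h2
    rw [M.map_smul_univ (fun _ => t) (fun _ => x)] at h1
    simp only [Finset.prod_const, Finset.card_univ, Fintype.card_fin, norm_smul, norm_pow,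
      norm_mul, norm_norm, Real.norm_of_nonneg h2.le] at h1
    rw [mul_pow, pow_succ t] at h1
    refine le_of_mul_le_mul_left (h1.trans_eq ?_) (pow_pos h2 m)
    ring
  have hlim : Tendsto (fun t : ℝ => t * (C * ‖x‖ ^ (m + 1))) (𝓝[>] 0) (𝓝 0) := by
    have : Tendsto (fun t : ℝ => t * (C * ‖x‖ ^ (m + 1))) (𝓝 0) (𝓝 (0 * _)) :=
      (continuous_id.mul continuous_const).tendsto _
    rw [zero_mul] at this
    exact this.mono_left nhdsWithin_le_nhds
  exact norm_le_zero_iff.1 (ge_of_tendsto hlim hb)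

/-- The homogeneous Taylor polynomial of degree `m` at the origin. -/
def taylorTerm (f : V → G) (m : ℕ) (x : V) : G :=
  ((m.factorial : ℝ)⁻¹ • iteratedFDeriv ℝ m f 0) fun _ => x

theorem contDiff_taylorTerm (f : V → G) (m : ℕ) {n : WithTop ℕ∞} :
    ContDiff ℝ n (taylorTerm f m) :=
  contDiff_diagonal _

/-- The derivative of order `m` of a diagonal is the sum over all permutations of the arguments; by
symmetry its `m!` terms agree, which cancels the factor `1 / m!`. -/
theorem iteratedFDeriv_taylorTerm {f : V → G} {m : ℕ} (hf : ContDiffAt ℝ m f 0) :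
    iteratedFDeriv ℝ m (taylorTerm f m) 0 = iteratedFDeriv ℝ m f 0 := by
  ext v
  rw [show taylorTerm f m = fun x => ((m.factorial : ℝ)⁻¹ • iteratedFDeriv ℝ m f 0) fun _ => x
    from rfl, ContinuousMultilinearMap.iteratedFDeriv_comp_diagonal]
  have hsymm : ∀ τ : Equiv.Perm (Fin m), ((m.factorial : ℝ)⁻¹ • iteratedFDeriv ℝ m f 0)
      (fun i => v (τ i)) = (m.factorial : ℝ)⁻¹ • iteratedFDeriv ℝ m f 0 v :=
    fun τ => congrArg ((m.factorial : ℝ)⁻¹ • ·) (iteratedFDeriv_comp_perm_of_contDiffAt hf v τ)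
  rw [Finset.sum_congr rfl fun τ _ => hsymm τ]
  rw [Finset.sum_const, Finset.card_univ, Fintype.card_perm, Fintype.card_fin,
    ← Nat.cast_smul_eq_nsmul ℝ, smul_smul, mul_inv_cancel₀ (by positivity), one_smul]

/-- The hypothesis `hQ` always holds, but is kept explicit because in
`iteratedFDeriv_eq_zero_of_isBigO` it comes from the induction hypothesis. -/
theorem iteratedFDeriv_sub_taylorTerm {f : V → G} (hf : ContDiffAt ℝ (⊤ : ℕ∞) f 0) {m : ℕ}
    (hQ : ∀ j < m, iteratedFDeriv ℝ j (taylorTerm f m) 0 = 0)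
    (h : ∀ j < m, iteratedFDeriv ℝ j f 0 = 0) :
    ∀ j < m + 1, iteratedFDeriv ℝ j (f - taylorTerm f m) 0 = 0 := by
  intro j hj
  have hfj : ∀ j : ℕ, ContDiffAt ℝ j f 0 := fun j => hf.of_le (by exact_mod_cast le_top)
  rw [iteratedFDeriv_sub_apply (hfj j) (contDiff_taylorTerm f m).contDiffAt]
  rcases Nat.lt_succ_iff_lt_or_eq.1 hj with hj | rfl
  · rw [h j hj, hQ j hj, sub_zero]
  · rw [iteratedFDeriv_taylorTerm (hfj _), sub_self]

theorem iteratedFDeriv_eq_zero_of_isBigO {f : V → G} (hf : ContDiffAt ℝ (⊤ : ℕ∞) f 0) {m : ℕ}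
    (h : f =O[𝓝 0] fun y : V => ‖y‖ ^ m) : ∀ j < m, iteratedFDeriv ℝ j f 0 = 0 := by
  induction m generalizing f with
  | zero => intro j hj; omega
  | succ m ih =>
    have hle : (fun y : V => ‖y‖ ^ (m + 1)) =O[𝓝 0] fun y : V => ‖y‖ ^ m :=
      (isLittleO_norm_pow_norm_pow (Nat.lt_succ_self m)).isBigO
    have hflat := ih hf (h.trans hle)
    have hsub := iteratedFDeriv_sub_taylorTerm hf
      (ih (contDiff_taylorTerm f m).contDiffAt (diagonal_isBigO _ _)) hflat
    have hO : (f - taylorTerm f m) =O[𝓝 0] fun y : V => ‖y‖ ^ (m + 1) := by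
      have := iteratedFDeriv_isBigO_of_eq_zero (hf.sub (contDiff_taylorTerm f m).contDiffAt)
        hsub (zero_add (m + 1))
      exact (this.norm_left.congr_left fun y => norm_iteratedFDeriv_zero).of_norm_left
    -- Both `f` and its difference with the Taylor term are of order `m + 1`, so the Taylor term is
    -- too; being homogeneous of degree `m`, it vanishes.
    have hQ : taylorTerm f m =O[𝓝 0] fun y : V => ‖y‖ ^ (m + 1) := by
      simpa using h.sub hO
    have hz : taylorTerm f m = 0 := funext fun x => diagonal_eq_zero_of_isBigO hQ x
    rwa [hz, sub_zero] at hsub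

theorem sub_taylorTerm_isBigO {f : V → G} (hf : ContDiffAt ℝ (⊤ : ℕ∞) f 0) {m : ℕ}
    (h : ∀ j < m, iteratedFDeriv ℝ j f 0 = 0) :
    (fun y => f y - taylorTerm f m y) =O[𝓝 0] fun y : V => ‖y‖ ^ (m + 1) := by
  have hsub := iteratedFDeriv_sub_taylorTerm hf
    (iteratedFDeriv_eq_zero_of_isBigO (contDiff_taylorTerm f m).contDiffAt
      (diagonal_isBigO _ _)) h
  have := iteratedFDeriv_isBigO_of_eq_zero (hf.sub (contDiff_taylorTerm f m).contDiffAt)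
    hsub (zero_add (m + 1))
  exact (this.norm_left.congr_left fun y => norm_iteratedFDeriv_zero).of_norm_left

/-- An estimate cannot be differentiated in general; for a smooth germ it can, since it amounts to
the vanishing of a jet. -/
theorem fderiv_isBigO_of_isBigO {f : V → G} (hf : ContDiffAt ℝ (⊤ : ℕ∞) f 0) {m : ℕ}
    (h : f =O[𝓝 0] fun y : V => ‖y‖ ^ (m + 1)) :
    fderiv ℝ f =O[𝓝 0] fun y : V => ‖y‖ ^ m := by
  have := iteratedFDeriv_isBigO_of_eq_zero hf (iteratedFDeriv_eq_zero_of_isBigO hf h)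
    (add_comm 1 m)
  exact (this.norm_left.congr_left fun y => norm_iteratedFDeriv_one f).of_norm_left

end Germs

/-! ### The apolar (Fischer) inner product and the splitting of homogeneous polynomials -/

section Fischer

variable {V : Type*} [NormedAddCommGroup V] [InnerProductSpace ℝ V]

theorem exists_lieDer_multilinear {k : ℕ} (L : V →L[ℝ] V)
    (M : ContinuousMultilinearMap ℝ (fun _ : Fin k => V) ℝ) :
    ∃ N : ContinuousMultilinearMap ℝ (fun _ : Fin k => V) ℝ,
      ∀ x, fderiv ℝ (fun x => M fun _ => x) x (L x) = N fun _ => x := by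
  classical
  refine ⟨∑ j : Fin k, M.compContinuousLinearMap
    (Function.update (fun _ => ContinuousLinearMap.id ℝ V) j L), fun x => ?_⟩
  let g : V →L[ℝ] (Fin k → V) := ContinuousLinearMap.pi fun _ => ContinuousLinearMap.id ℝ V
  have h : HasFDerivAt (fun x : V => M fun _ => x) ((M.linearDeriv (g x)).comp g) x :=
    (M.hasFDerivAt (g x)).comp x g.hasFDerivAt
  rw [h.fderiv, ContinuousLinearMap.comp_apply, ContinuousMultilinearMap.linearDeriv_apply,
    sum_apply]
  refine Finset.sum_congr rfl fun j _ => ?_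
  rw [ContinuousMultilinearMap.compContinuousLinearMap_apply]
  congr 1
  funext i
  by_cases hij : i = j
  · subst hij; simp [g]
  · simp [g, hij]

/-- The Lie derivative `F ↦ (x ↦ dF_x(L x))` of homogeneous polynomials along a linear vector
field. -/
def lieDer (L : V →L[ℝ] V) (k : ℕ) : homPoly V k →ₗ[ℝ] homPoly V k where
  toFun F := ⟨fun x => fderiv ℝ F x (L x), by
    obtain ⟨M, hM⟩ := F.2
    obtain ⟨N, hN⟩ := exists_lieDer_multilinear L M
    refine ⟨N, fun x => ?_⟩
    rw [← hN, ← funext hM]⟩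
  map_add' F G := by
    ext x
    have hF := differentiable_of_mem_homPoly F.2 x
    have hG := differentiable_of_mem_homPoly G.2 x
    simp [fderiv_add hF hG]
  map_smul' c F := by
    ext x
    have hF := differentiable_of_mem_homPoly F.2 x
    simp [fderiv_const_smul hF c]

theorem lieDer_apply (L : V →L[ℝ] V) {k : ℕ} (F : homPoly V k) (x : V) :
    (lieDer L k F : V → ℝ) x = fderiv ℝ F x (L x) := rfl

variable [FiniteDimensional ℝ V]

/-- The `k`-th tensor power of `x`, in the coordinates of an orthonormal basis. -/
def tensorPow (k : ℕ) (x : V) : EuclideanSpace ℝ (Fin k → Fin (Module.finrank ℝ V)) :=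
  WithLp.toLp 2 fun i => ∏ j, inner ℝ (stdOrthonormalBasis ℝ V (i j)) x

theorem inner_tensorPow (k : ℕ) (x y : V) :
    inner ℝ (tensorPow k x) (tensorPow k y) = inner ℝ x y ^ k := by
  rw [← (stdOrthonormalBasis ℝ V).sum_inner_mul_inner x y, Fintype.sum_pow]
  simp only [PiLp.inner_apply, tensorPow]
  refine Finset.sum_congr rfl fun i _ => ?_
  rw [Finset.prod_mul_distrib, real_inner_eq_re_inner]
  simp only [real_inner_comm x]
  simp [mul_comm]

/-- The symmetric tensors. -/
def symTensor (V : Type*) [NormedAddCommGroup V] [InnerProductSpace ℝ V] [FiniteDimensional ℝ V]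
    (k : ℕ) : Submodule ℝ (EuclideanSpace ℝ (Fin k → Fin (Module.finrank ℝ V))) :=
  Submodule.span ℝ (Set.range (tensorPow (V := V) k))

theorem tensorPow_mem (k : ℕ) (x : V) : tensorPow k x ∈ symTensor V k :=
  Submodule.subset_span ⟨x, rfl⟩

/-- The polynomial function of a symmetric tensor. -/
def symTensorToPoly (V : Type*) [NormedAddCommGroup V] [InnerProductSpace ℝ V]
    [FiniteDimensional ℝ V] (k : ℕ) : symTensor V k →ₗ[ℝ] homPoly V k where
  toFun c := ⟨fun x => inner ℝ (c : EuclideanSpace ℝ _) (tensorPow k x), by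
    refine ⟨∑ i, (c : EuclideanSpace ℝ (Fin k → Fin (Module.finrank ℝ V))) i •
      (ContinuousMultilinearMap.mkPiAlgebra ℝ (Fin k) ℝ).compContinuousLinearMap
        (fun j => innerSL ℝ (stdOrthonormalBasis ℝ V (i j))), fun x => ?_⟩
    simp [PiLp.inner_apply, tensorPow, mul_comm]⟩
  map_add' c d := by ext x; simp [inner_add_left]
  map_smul' a c := by ext x; simp [inner_smul_left]

theorem symTensorToPoly_apply {k : ℕ} (c : symTensor V k) (x : V) :
    (symTensorToPoly V k c : V → ℝ) x = inner ℝ (c : EuclideanSpace ℝ _) (tensorPow k x) := rfl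

theorem symTensorToPoly_bijective (k : ℕ) : Function.Bijective (symTensorToPoly V k) := by
  constructor
  · rw [injective_iff_map_eq_zero]
    intro c hc
    -- A symmetric tensor whose polynomial vanishes is orthogonal to all powers, hence to their
    -- span, which contains it.
    have h : ∀ d ∈ symTensor V k, inner ℝ (c : EuclideanSpace ℝ _) d = 0 := by
      intro d hd
      induction hd using Submodule.span_induction with
      | mem d hd =>
        obtain ⟨x, rfl⟩ := hd
        exact congrFun (congrArg Subtype.val hc) x
      | zero => simp
      | add a b _ _ ha hb => rw [inner_add_right, ha, hb, add_zero]
      | smul r a _ ha => rw [inner_smul_right, ha, mul_zero]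
    exact Subtype.ext (inner_self_eq_zero.1 (h c c.2))
  · rintro ⟨F, M, hM⟩
    let b := stdOrthonormalBasis ℝ V
    let c : EuclideanSpace ℝ (Fin k → Fin (Module.finrank ℝ V)) :=
      WithLp.toLp 2 fun i => M fun j => b (i j)
    -- The coefficient tensor of `M` need not be symmetric; projecting it leaves its inner products
    -- with powers `x^{⊗k}` unchanged.
    refine ⟨(symTensor V k).orthogonalProjectionOnto c, ?_⟩
    ext x
    rw [symTensorToPoly_apply]
    have h1 : inner ℝ (((symTensor V k).orthogonalProjectionOnto c : symTensor V k) :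
        EuclideanSpace ℝ _) (tensorPow k x) = inner ℝ c (tensorPow k x) := by
      exact Submodule.inner_orthogonalProjectionOnto_eq_of_mem_right
        (⟨tensorPow k x, tensorPow_mem k x⟩ : symTensor V k) c
    rw [h1]
    change _ = F x
    have hx : x = ∑ i, inner ℝ (b i) x • b i := (b.sum_repr' x).symm
    have h2 : M (fun _ => x) = M (fun _ => ∑ i, inner ℝ (b i) x • b i) := by rw [← hx]
    rw [hM, h2, M.map_sum]
    simp only [PiLp.inner_apply, c, tensorPow]
    refine Finset.sum_congr rfl fun i _ => ?_
    rw [M.map_smul_univ (fun j => inner ℝ (b (i j)) x) (fun j => b (i j))]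
    simp [b]

/-- Homogeneous polynomials are symmetric tensors. -/
def symTensorEquiv (V : Type*) [NormedAddCommGroup V] [InnerProductSpace ℝ V]
    [FiniteDimensional ℝ V] (k : ℕ) : symTensor V k ≃ₗ[ℝ] homPoly V k :=
  LinearEquiv.ofBijective (symTensorToPoly V k) (symTensorToPoly_bijective k)

theorem lieDer_symTensor_tensorPow (L : V →L[ℝ] V) (k : ℕ) (x y : V) :
    (lieDer L k (symTensorEquiv V k ⟨tensorPow k x, tensorPow_mem k x⟩) : V → ℝ) y =
      k * inner ℝ x y ^ (k - 1) * inner ℝ x (L y) := by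
  rw [lieDer_apply]
  have h : ((symTensorEquiv V k ⟨tensorPow k x, tensorPow_mem k x⟩ : homPoly V k) : V → ℝ) =
      fun y => (innerSL ℝ x y) ^ k := funext fun y => inner_tensorPow k x y
  rw [h, (((innerSL ℝ x).hasFDerivAt (x := y)).pow k).fderiv]
  simp

/-- By bilinearity it is enough to take two powers `x^{⊗k}` and `y^{⊗k}`. Pairing with a power is
evaluation, so both sides are `k ⟨x, y⟩ᵏ⁻¹ ⟨x, L y⟩`. -/
theorem inner_lieDer_symTensor (L : V →L[ℝ] V) (k : ℕ) (c d : symTensor V k) :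
    inner ℝ ((symTensorEquiv V k).symm (lieDer L k (symTensorEquiv V k c))) d =
      inner ℝ c ((symTensorEquiv V k).symm
        (lieDer (ContinuousLinearMap.adjoint L) k (symTensorEquiv V k d))) := by
  have hrep : ∀ (G : homPoly V k) (x : V), inner ℝ ((symTensorEquiv V k).symm G)
      (⟨tensorPow k x, tensorPow_mem k x⟩ : symTensor V k) = (G : V → ℝ) x := by
    intro G x
    conv_rhs => rw [← (symTensorEquiv V k).apply_symm_apply G]
    rfl
  have hrep' : ∀ (G : homPoly V k) (x : V),
      inner ℝ (⟨tensorPow k x, tensorPow_mem k x⟩ : symTensor V k)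
        ((symTensorEquiv V k).symm G) = (G : V → ℝ) x := fun G x =>
    (real_inner_comm _ _).trans (hrep G x)
  have hspan : ∀ c : symTensor V k, c ∈ Submodule.span ℝ
      ((↑) ⁻¹' Set.range (tensorPow (V := V) k) : Set (symTensor V k)) := fun c => by
    have h : Submodule.span ℝ ((↑) ⁻¹' Set.range (tensorPow (V := V) k) :
        Set (symTensor V k)) = ⊤ := Submodule.span_span_coe_preimage
    rw [h]
    exact Submodule.mem_top
  induction hspan c using Submodule.span_induction with
  | zero => simp
  | add a b _ _ ha hb => simp only [map_add, inner_add_left, ha, hb]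
  | smul r a _ ha =>
    simp only [map_smul]
    exact (real_inner_smul_left _ _ r).trans
      ((congrArg (r * ·) ha).trans (real_inner_smul_left _ _ r).symm)
  | mem c hc =>
    obtain ⟨x, hx⟩ := hc
    obtain rfl : ⟨tensorPow k x, tensorPow_mem k x⟩ = c := Subtype.ext hx
    induction hspan d using Submodule.span_induction with
    | zero => simp
    | add a b _ _ ha hb => simp only [map_add, inner_add_right, ha, hb]
    | smul r a _ ha =>
      simp only [map_smul]
      exact (real_inner_smul_right _ _ r).trans
        ((congrArg (r * ·) ha).trans (real_inner_smul_right _ _ r).symm)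
    | mem d hd =>
      obtain ⟨y, hy⟩ := hd
      obtain rfl : ⟨tensorPow k y, tensorPow_mem k y⟩ = d := Subtype.ext hy
      rw [hrep, lieDer_symTensor_tensorPow, hrep', lieDer_symTensor_tensorPow,
        ContinuousLinearMap.adjoint_inner_right, real_inner_comm x y, real_inner_comm x (L y)]

/-- The operator on symmetric tensors that corresponds to `lieDer L k`. -/
def symTensorLieDer (L : V →L[ℝ] V) (k : ℕ) : symTensor V k →ₗ[ℝ] symTensor V k :=
  (symTensorEquiv V k).symm.toLinearMap ∘ₗ lieDer L k ∘ₗ (symTensorEquiv V k).toLinearMap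

theorem adjoint_symTensorLieDer (L : V →L[ℝ] V) (k : ℕ) :
    (symTensorLieDer L k).adjoint = symTensorLieDer (ContinuousLinearMap.adjoint L) k := by
  rw [eq_comm, LinearMap.eq_adjoint_iff]
  intro c d
  have h := inner_lieDer_symTensor L k d c
  rw [real_inner_comm, real_inner_comm _ d] at h
  exact h.symm

/-- Every homogeneous polynomial is the sum of an element of the kernel of `lieDer Lᵀ` and an
element of the range of `lieDer L`. -/
theorem exists_eq_add_lieDer (L : V →L[ℝ] V) {k : ℕ} (F : homPoly V k) :
    ∃ P G : homPoly V k, lieDer (ContinuousLinearMap.adjoint L) k P = 0 ∧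
      F = P + lieDer L k G := by
  obtain ⟨a, ⟨g, rfl⟩, b, hb, hab⟩ := (symTensorLieDer L k).range.exists_add_mem_mem_orthogonal
    ((symTensorEquiv V k).symm F)
  rw [LinearMap.orthogonal_range, adjoint_symTensorLieDer, LinearMap.mem_ker] at hb
  refine ⟨symTensorEquiv V k b, symTensorEquiv V k g, ?_, ?_⟩
  · exact (symTensorEquiv V k).symm.map_eq_zero_iff.1 hb
  · rw [← (symTensorEquiv V k).apply_symm_apply F, hab, map_add, add_comm]
    congr 1
    exact (symTensorEquiv V k).apply_symm_apply _

/-- If `A*A F = 0` then `|A F|² = ⟨F, A*A F⟩ = 0`. This makes the sum direct, and later gives the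
uniqueness of the equivariant splitting. -/
theorem lieDer_eq_zero_of_lieDer_adjoint {L : V →L[ℝ] V} {k : ℕ} {F : homPoly V k}
    (h : lieDer (ContinuousLinearMap.adjoint L) k (lieDer L k F) = 0) : lieDer L k F = 0 := by
  have h1 := inner_lieDer_symTensor L k ((symTensorEquiv V k).symm F)
    ((symTensorEquiv V k).symm (lieDer L k F))
  rw [LinearEquiv.apply_symm_apply, LinearEquiv.apply_symm_apply, h, map_zero,
    inner_zero_right, inner_self_eq_zero] at h1
  exact (symTensorEquiv V k).symm.map_eq_zero_iff.1 h1

end Fischer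

/-! ### Hamiltonian vector fields and symmetries -/

section Hamiltonian

variable {V : Type*} [NormedAddCommGroup V] [InnerProductSpace ℝ V]

theorem isSymmSndFDerivAt_of_smooth {F : V → ℝ} {x : V} (hF : ContDiffAt ℝ (⊤ : ℕ∞) F x)
    (u v : V) : fderiv ℝ (fderiv ℝ F) x u v = fderiv ℝ (fderiv ℝ F) x v u := by
  have : ContDiffAt ℝ 2 F x := hF.of_le (by norm_cast)
  exact (this.isSymmSndFDerivAt (by simp)).eq u v

theorem quadPart_eq_taylorTerm (H : V → ℝ) : quadPart H = taylorTerm H 2 := by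
  funext x
  simp [quadPart, taylorTerm, iteratedFDeriv_two_apply]

theorem taylorTerm_mem_homPoly (F : V → ℝ) (k : ℕ) : taylorTerm F k ∈ homPoly V k :=
  ⟨_, fun _ => rfl⟩

theorem quadPart_mem_homPoly (H : V → ℝ) : quadPart H ∈ homPoly V 2 := by
  rw [quadPart_eq_taylorTerm]
  exact taylorTerm_mem_homPoly H 2

theorem contDiff_of_mem_homPoly {k : ℕ} {F : V → ℝ} (hF : F ∈ homPoly V k) {n : WithTop ℕ∞} :
    ContDiff ℝ n F := by
  obtain ⟨M, hM⟩ := hF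
  rw [funext hM]
  exact contDiff_diagonal M

theorem isBigO_of_mem_homPoly {k : ℕ} {F : V → ℝ} (hF : F ∈ homPoly V k) (l : Filter V) :
    F =O[l] fun y => ‖y‖ ^ k := by
  obtain ⟨M, hM⟩ := hF
  rw [funext hM]
  exact diagonal_isBigO M l

theorem fderiv_quadPart {H : V → ℝ} (hH : ContDiffAt ℝ (⊤ : ℕ∞) H 0) (x v : V) :
    fderiv ℝ (quadPart H) x v = fderiv ℝ (fderiv ℝ H) 0 x v := by
  have h1 : HasFDerivAt (fun x => fderiv ℝ (fderiv ℝ H) 0 x x) _ x :=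
    (fderiv ℝ (fderiv ℝ H) 0).hasFDerivAt.clm_apply (hasFDerivAt_id x)
  have h2 : HasFDerivAt (quadPart H) _ x := h1.const_mul (1 / 2 : ℝ)
  rw [h2.fderiv]
  have := isSymmSndFDerivAt_of_smooth hH x v
  simp [this]
  ring

theorem fderiv_comp_unit (F : V → ℝ) (A : GLin V) (x v : V) :
    fderiv ℝ (fun y => F ((A : V →L[ℝ] V) y)) x v =
      fderiv ℝ F ((A : V →L[ℝ] V) x) ((A : V →L[ℝ] V) v) := by
  let e : V ≃L[ℝ] V := ContinuousLinearEquiv.unitsEquiv ℝ V A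
  have h : fderiv ℝ (F ∘ e) x = (fderiv ℝ F (e x)).comp (e : V →L[ℝ] V) := e.comp_right_fderiv
  exact congrArg (fun l : V →L[ℝ] ℝ => l v) h

theorem fderiv_units_smul (c : ℤˣ) (F : V → ℝ) (x v : V) :
    fderiv ℝ (fun y => c • F y) x v = c • fderiv ℝ F x v := by
  rcases Int.units_eq_one_or c with rfl | rfl
  · simp
  · simp only [Units.neg_smul, one_smul]
    rw [fderiv_fun_neg]
    rfl

theorem omega_units_smul (ω : LinearMap.BilinForm ℝ V) (c : ℤˣ) (u v : V) : ω (c • u) v = c • ω u v := by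
  rcases Int.units_eq_one_or c with rfl | rfl
  · simp
  · simp [Units.neg_smul]

variable [FiniteDimensional ℝ V]

/-- The isomorphism `V* → V` defined by `ω`, as a continuous linear map. -/
def dualToVec (ω : LinearMap.BilinForm ℝ V) (hω : ω.Nondegenerate) : (V →L[ℝ] ℝ) →L[ℝ] V :=
  LinearMap.toContinuousLinearMap
    ((ω.toDual hω).symm.toLinearMap ∘ₗ ContinuousLinearMap.coeLM ℝ)

theorem omega_dualToVec (ω : LinearMap.BilinForm ℝ V) (hω : ω.Nondegenerate) (l : V →L[ℝ] ℝ)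
    (v : V) : ω (dualToVec ω hω l) v = l v := by
  simp [dualToVec]

theorem hamVF_eq_dualToVec (ω : LinearMap.BilinForm ℝ V) (hω : ω.Nondegenerate) (F : V → ℝ) :
    hamVF ω hω F = fun x => dualToVec ω hω (fderiv ℝ F x) := rfl

theorem eq_of_omega_eq {ω : LinearMap.BilinForm ℝ V} (hω : ω.Nondegenerate) {u v : V}
    (h : ∀ w, ω u w = ω v w) : u = v :=
  (ω.toDual hω).injective (LinearMap.ext fun w => h w)

theorem contDiffAt_hamVF {ω : LinearMap.BilinForm ℝ V} {hω : ω.Nondegenerate} {F : V → ℝ} {x : V}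
    (hF : ContDiffAt ℝ (⊤ : ℕ∞) F x) : ContDiffAt ℝ (⊤ : ℕ∞) (hamVF ω hω F) x :=
  (dualToVec ω hω).contDiff.contDiffAt.comp x (hF.fderiv_right le_rfl)

theorem omega_fderiv_hamVF {ω : LinearMap.BilinForm ℝ V} {hω : ω.Nondegenerate} {F : V → ℝ} {x : V}
    (hF : ContDiffAt ℝ (⊤ : ℕ∞) F x) (u v : V) :
    ω (fderiv ℝ (hamVF ω hω F) x u) v = fderiv ℝ (fderiv ℝ F) x u v := by
  have h1 : ContDiffAt ℝ 1 (fderiv ℝ F) x := hF.fderiv_right (by norm_cast)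
  have h2 : HasFDerivAt (hamVF ω hω F) ((dualToVec ω hω).comp (fderiv ℝ (fderiv ℝ F) x)) x :=
    (dualToVec ω hω).hasFDerivAt.comp x (h1.differentiableAt one_ne_zero).hasFDerivAt
  rw [h2.fderiv]
  exact omega_dualToVec ω hω _ _

/-- Both sides correspond under `ω` to the Hessian of `H` at the origin. -/
theorem hamVF_quadPart {ω : LinearMap.BilinForm ℝ V} {hω : ω.Nondegenerate} {H : V → ℝ}
    (hH : ContDiffAt ℝ (⊤ : ℕ∞) H 0) (x : V) :
    hamVF ω hω (quadPart H) x = fderiv ℝ (hamVF ω hω H) 0 x :=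
  eq_of_omega_eq hω fun v => by
    rw [hamVF_spec, fderiv_quadPart hH, omega_fderiv_hamVF hH]

theorem adOp_quadPart {ω : LinearMap.BilinForm ℝ V} {hω : ω.Nondegenerate} {H : V → ℝ}
    (hH : ContDiffAt ℝ (⊤ : ℕ∞) H 0) {k : ℕ} (F : homPoly V k) :
    adOp ω hω (quadPart H) k F = lieDer (fderiv ℝ (hamVF ω hω H) 0) k F := by
  funext x
  change ω (hamVF ω hω F x) (hamVF ω hω (quadPart H) x) = _
  rw [hamVF_spec, hamVF_quadPart hH, lieDer_apply]

/-- The invariants of `S` are the kernel of the Lie derivative along `Lᵀ`. -/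
theorem invariant_groupS_iff (L : V →L[ℝ] V) {k : ℕ} (F : homPoly V k) :
    (∀ A ∈ groupS L, ∀ x, (F : V → ℝ) ((A : V →L[ℝ] V) x) = (F : V → ℝ) x) ↔
      lieDer (ContinuousLinearMap.adjoint L) k F = 0 := by
  set B := ContinuousLinearMap.adjoint L with hB
  have hd := differentiable_of_mem_homPoly F.2
  have hexp : ∀ (x : V) (s : ℝ), HasDerivAt (fun s : ℝ => NormedSpace.exp (s • B) x)
      (B (NormedSpace.exp (s • B) x)) s := fun x s => by
    have h := hasDerivAt_exp_smul_const' (𝕂 := ℝ) B s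
    exact ((ContinuousLinearMap.apply ℝ V x).hasFDerivAt.comp_hasDerivAt s h)
  have hder : ∀ (x : V) (s : ℝ), HasDerivAt
      (fun s : ℝ => (F : V → ℝ) (NormedSpace.exp (s • B) x))
      ((lieDer B k F : V → ℝ) (NormedSpace.exp (s • B) x)) s := fun x s =>
    (hd _).hasFDerivAt.comp_hasDerivAt s (hexp x s)
  constructor
  · intro h
    ext x
    have h1 := hder x 0
    have h2 : (fun s : ℝ => (F : V → ℝ) (NormedSpace.exp (s • B) x)) = fun _ => (F : V → ℝ) x :=
      funext fun s => h (expTranspose L (Multiplicative.ofAdd s))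
        (Subgroup.le_topologicalClosure _ ⟨_, rfl⟩) x
    rw [h2, zero_smul, NormedSpace.exp_zero] at h1
    exact h1.unique (hasDerivAt_const _ _)
  · intro h A hA x
    have hconst : ∀ s : ℝ, (F : V → ℝ) (NormedSpace.exp (s • B) x) = (F : V → ℝ) x := by
      intro s
      have h1 := is_const_of_deriv_eq_zero (fun s => (hder x s).differentiableAt)
        (fun s => by rw [(hder x s).deriv, h]; rfl) s 0
      simpa using h1
    -- Invariance under one group element is a closed condition, so it passes from the one-parameter
    -- group to its closure.
    have hcl : IsClosed {A : GLin V | (F : V → ℝ) ((A : V →L[ℝ] V) x) = (F : V → ℝ) x} :=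
      isClosed_eq (hd.continuous.comp
        ((ContinuousLinearMap.apply ℝ V x).continuous.comp Units.continuous_val))
        continuous_const
    refine closure_minimal ?_ hcl hA
    rintro _ ⟨s, rfl⟩
    exact hconst s.toAdd

theorem mem_homPolyInv_groupS_iff (L : V →L[ℝ] V) {k : ℕ} {F : V → ℝ} :
    F ∈ homPolyInv (groupS L).subtype 1 k ↔
      ∃ hF : F ∈ homPoly V k, lieDer (ContinuousLinearMap.adjoint L) k ⟨F, hF⟩ = 0 := by
  constructor
  · rintro ⟨hF, h⟩
    exact ⟨hF, (invariant_groupS_iff L ⟨F, hF⟩).1 fun A hA x => by simpa using h ⟨A, hA⟩ x⟩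
  · rintro ⟨hF, h⟩
    exact ⟨hF, fun A x => by
      simpa using (invariant_groupS_iff L ⟨F, hF⟩).2 h A A.2 x⟩

/-- `𝒫ᵏ = ad_{H²}(𝒫ᵏ) ⊕ 𝒫ᵏ(S)`. -/
theorem isComplementAd_groupS {ω : LinearMap.BilinForm ℝ V} {hω : ω.Nondegenerate} {H : V → ℝ}
    (hH : ContDiffAt ℝ (⊤ : ℕ∞) H 0) (k : ℕ) :
    IsComplementAd ω hω H k
      (homPolyInv (groupS (fderiv ℝ (hamVF ω hω H) 0)).subtype 1 k) := by
  set L := fderiv ℝ (hamVF ω hω H) 0 with hL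
  constructor
  · rw [eq_bot_iff]
    rintro _ ⟨⟨F, rfl⟩, hF⟩
    obtain ⟨hF, h0⟩ := (mem_homPolyInv_groupS_iff L).1 hF
    rw [Submodule.mem_bot, adOp_quadPart hH]
    have h1 : (⟨adOp ω hω (quadPart H) k F, hF⟩ : homPoly V k) = lieDer L k F :=
      Subtype.ext (adOp_quadPart hH F)
    rw [h1] at h0
    rw [lieDer_eq_zero_of_lieDer_adjoint h0]
    rfl
  · refine le_antisymm (sup_le ?_ fun F hF => hF.1) fun F hF => ?_
    · rintro _ ⟨F, rfl⟩
      rw [adOp_quadPart hH]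
      exact Subtype.prop _
    · obtain ⟨P, G, hP, hFPG⟩ := exists_eq_add_lieDer L ⟨F, hF⟩
      rw [Submodule.mem_sup]
      refine ⟨_, ⟨G, rfl⟩, P, (mem_homPolyInv_groupS_iff L).2 ⟨P.2, hP⟩, ?_⟩
      rw [adOp_quadPart hH, add_comm]
      exact (congrArg Subtype.val hFPG).symm

section Symmetry

variable {ω : LinearMap.BilinForm ℝ V} {hω : ω.Nondegenerate} {G : Type*} [Group G]
  {ρ : G →* GLin V} {χ : G →* ℤˣ}

/-- Pair both sides with `g v`, which exhausts `V`, and use `χ(g)² = 1`. For `c = χ(g)` the signs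
cancel and `X_F` commutes with `g`. -/
theorem hamVF_apply_of_semiinvariant (hρ : IsSemisymplectic ω ρ χ) {F : V → ℝ} {g : G} {c : ℤˣ}
    (hF : ∀ x, F ((ρ g : V →L[ℝ] V) x) = c • F x) (x : V) :
    hamVF ω hω F ((ρ g : V →L[ℝ] V) x) = (χ g * c) • (ρ g : V →L[ℝ] V) (hamVF ω hω F x) := by
  refine eq_of_omega_eq hω fun w => ?_
  obtain ⟨v, rfl⟩ : ∃ v, (ρ g : V →L[ℝ] V) v = w :=
    ⟨(((ρ g)⁻¹ : GLin V) : V →L[ℝ] V) w, by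
      rw [← mul_apply_eq_comp, Units.mul_inv]
      rfl⟩
  rw [hamVF_spec, omega_units_smul, hρ, hamVF_spec, ← fderiv_comp_unit, funext hF,
    fderiv_units_smul, smul_smul, mul_right_comm, ← sq, Int.units_sq, one_mul]

/-- Both sides have the same differential, as it is read off from the vector field, and both vanish
at the origin. -/
theorem semiinvariant_of_hamVF_equivariant (hρ : IsSemisymplectic ω ρ χ) {F : V → ℝ}
    (hF : Differentiable ℝ F) (h0 : F 0 = 0) {τ : G →* ℤˣ}
    (h : IsEquivariant ρ τ (hamVF ω hω F)) (g : G) (x : V) :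
    F ((ρ g : V →L[ℝ] V) x) = (χ g * τ g) • F x := by
  have hd1 : Differentiable ℝ fun y => F ((ρ g : V →L[ℝ] V) y) :=
    hF.comp (ρ g : V →L[ℝ] V).differentiable
  have hd2 : Differentiable ℝ fun y => (χ g * τ g) • F y := by
    rcases Int.units_eq_one_or (χ g * τ g) with hc | hc
    · simpa [hc] using hF
    · simpa [hc, Units.neg_smul] using hF.neg
  have hz : ∀ y, fderiv ℝ (fun y => F ((ρ g : V →L[ℝ] V) y) - (χ g * τ g) • F y) y = 0 := by
    intro y
    ext v
    rw [fderiv_fun_sub (hd1 y) (hd2 y), sub_apply, fderiv_comp_unit,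
      fderiv_units_smul, ← hamVF_spec ω hω, h, omega_units_smul, hρ, hamVF_spec, smul_smul,
      mul_comm, sub_self]
    rfl
  have := is_const_of_fderiv_eq_zero (hd1.sub hd2) hz x 0
  simpa [h0, sub_eq_zero] using this

end Symmetry

end Hamiltonian

/-! ### Symplectic changes of coordinates: the implicit midpoint map -/

section Midpoint

open Asymptotics Filter

variable {V : Type*} [NormedAddCommGroup V] [InnerProductSpace ℝ V]

theorem norm_pow_isBigO_norm_pow {V : Type*} [NormedAddCommGroup V] {a b : ℕ} (h : a ≤ b) :
    (fun y : V => ‖y‖ ^ b) =O[𝓝 0] fun y : V => ‖y‖ ^ a := by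
  obtain ⟨c, rfl⟩ := Nat.exists_eq_add_of_le h
  refine IsBigO.of_bound 1 ?_
  filter_upwards [Metric.ball_mem_nhds (0 : V) one_pos] with y hy
  rw [mem_ball_zero_iff] at hy
  rw [one_mul, norm_pow, norm_pow, norm_norm]
  exact pow_le_pow_of_le_one (norm_nonneg y) hy.le (Nat.le_add_right a c)

theorem isBigO_comp_sub_comp {W : Type*} [NormedAddCommGroup W] [NormedSpace ℝ W] {f : V → W}
    {m : ℕ} (hd : ∀ᶠ y in 𝓝 (0 : V), DifferentiableAt ℝ f y)
    (h : fderiv ℝ f =O[𝓝 0] fun y : V => ‖y‖ ^ m) {u w : V → V}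
    (hu : u =O[𝓝 0] fun y => y) (hw : w =O[𝓝 0] fun y => y) :
    (fun y => f (u y) - f (w y)) =O[𝓝 0] fun y => ‖y‖ ^ m * ‖u y - w y‖ := by
  obtain ⟨C, hC0, hC⟩ := h.exists_nonneg
  obtain ⟨A, hA0, hA⟩ := hu.exists_nonneg
  obtain ⟨B, hB0, hB⟩ := hw.exists_nonneg
  obtain ⟨ε, hε, hball⟩ := Metric.eventually_nhds_iff.1 (hd.and hC.bound)
  have hsmall : ∀ᶠ y : V in 𝓝 0, (A + B) * ‖y‖ < ε := by
    have : Tendsto (fun y : V => (A + B) * ‖y‖) (𝓝 0) (𝓝 ((A + B) * ‖(0 : V)‖)) :=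
      (continuous_const.mul continuous_norm).tendsto 0
    rw [norm_zero, mul_zero] at this
    exact this.eventually (gt_mem_nhds hε)
  refine IsBigO.of_bound (C * (A + B) ^ m) ?_
  filter_upwards [hsmall, hA.bound, hB.bound] with y hy hyA hyB
  have hsub : ∀ z ∈ Metric.closedBall (0 : V) ((A + B) * ‖y‖),
      DifferentiableAt ℝ f z ∧ ‖fderiv ℝ f z‖ ≤ C * ((A + B) * ‖y‖) ^ m := by
    intro z hz
    rw [mem_closedBall_zero_iff] at hz
    have h1 := hball (y := z) (by rw [dist_zero_right]; exact hz.trans_lt hy)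
    refine ⟨h1.1, h1.2.trans ?_⟩
    rw [norm_pow, norm_norm]
    gcongr
  have hmem : ∀ {v : V} {c : ℝ}, ‖v‖ ≤ c * ‖y‖ → c ≤ A + B →
      v ∈ Metric.closedBall (0 : V) ((A + B) * ‖y‖) := fun hv hc =>
    mem_closedBall_zero_iff.2 (hv.trans (by gcongr))
  have := (convex_closedBall (0 : V) ((A + B) * ‖y‖)).norm_image_sub_le_of_norm_fderiv_le
    (fun z hz => (hsub z hz).1) (fun z hz => (hsub z hz).2)
    (hmem hyB (by linarith)) (hmem hyA (by linarith))
  refine this.trans_eq ?_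
  rw [norm_mul, norm_norm, norm_pow, norm_norm, mul_pow]
  ring

variable [FiniteDimensional ℝ V]

/-- A smooth map tangent to the identity at the origin is a local diffeomorphism. -/
theorem exists_local_inverse {a : V → V} (ha : ContDiff ℝ (⊤ : ℕ∞) a)
    (h1 : fderiv ℝ a 0 = ContinuousLinearMap.id ℝ V) :
    ∃ φ : OpenPartialHomeomorph V V, (φ : V → V) = a ∧ 0 ∈ φ.source ∧
      ∀ z ∈ φ.source, ContDiffAt ℝ (⊤ : ℕ∞) φ.symm (a z) ∧
        Function.Surjective (fderiv ℝ a z) := by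
  have hd : Differentiable ℝ a := ha.differentiable (by simp)
  have hder : HasFDerivAt a ((ContinuousLinearEquiv.refl ℝ V : V ≃L[ℝ] V) : V →L[ℝ] V) 0 := by
    have := (hd 0).hasFDerivAt
    rwa [h1] at this
  let ψ := ha.contDiffAt.toOpenPartialHomeomorph a hder (by simp)
  have h0 : (0 : V) ∈ ψ.source := ha.contDiffAt.mem_toOpenPartialHomeomorph_source hder (by simp)
  -- Restriction to `W` makes the inverse smooth at every point of its domain, not only at the
  -- origin.
  let W : Set V := {z | IsUnit (fderiv ℝ a z)}
  have hW : IsOpen W := Units.isOpen.preimage (ha.continuous_fderiv (by simp))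
  have hW0 : (0 : V) ∈ W := by
    change IsUnit (fderiv ℝ a 0)
    rw [h1]
    exact isUnit_one
  refine ⟨ψ.restrOpen W hW, rfl, ⟨h0, hW0⟩, fun z hz => ?_⟩
  obtain ⟨A, hA⟩ := hz.2
  let e : V ≃L[ℝ] V := ContinuousLinearEquiv.unitsEquiv ℝ V A
  have he : (e : V →L[ℝ] V) = fderiv ℝ a z := hA
  have hψ : ψ.symm (a z) = z := ψ.left_inv hz.1
  refine ⟨?_, ?_⟩
  · refine ψ.contDiffAt_symm (a := a z) (f₀' := e) (ψ.map_source hz.1) ?_ ?_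
    · rw [hψ, he]
      exact (hd z).hasFDerivAt
    · exact ha.contDiffAt
  · rw [← he]
    exact e.surjective

/-- The map is defined by `ξ(y) - y = X_F(z)` with `z = (y + ξ(y)) / 2`, that is `ξ = m_{1/2} ∘
m_{-1/2}⁻¹` for `m_t = id + t X_F`. Since `dX_F` is skew for `ω`, the pull-back of `ω` by `m_t`
depends only on `t²`, so `m_{1/2}` and `m_{-1/2}` pull `ω` back to the same form and `ξ` preserves
it. -/
theorem exists_symplecticChange (ω : LinearMap.BilinForm ℝ V) (hωalt : ω.IsAlt)
    (hω : ω.Nondegenerate) {k : ℕ} (hk : 3 ≤ k) {F : V → ℝ} (hF : F ∈ homPoly V k) :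
    ∃ U ξ, IsSymplecticChange ω U ξ ∧
      (fun y => ξ y - y - hamVF ω hω F y) =O[𝓝 0] (fun y => ‖y‖ ^ k) ∧
      ∀ e : V →L[ℝ] V, (∀ x, hamVF ω hω F (e x) = e (hamVF ω hω F x)) →
        ∀ᶠ y in 𝓝 0, ξ (e y) = e (ξ y) := by
  obtain ⟨n, rfl⟩ : ∃ n, k = n + 3 := ⟨k - 3, by omega⟩
  set X := hamVF ω hω F with hX
  have hFs : ContDiff ℝ (⊤ : ℕ∞) F := contDiff_of_mem_homPoly hF
  have hXs : ContDiff ℝ (⊤ : ℕ∞) X :=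
    contDiff_iff_contDiffAt.2 fun x => contDiffAt_hamVF hFs.contDiffAt
  have hXd : Differentiable ℝ X := hXs.differentiable (by simp)
  have hXO : X =O[𝓝 0] fun y => ‖y‖ ^ (n + 2) :=
    ((dualToVec ω hω).isBigO_comp _ _).trans
      (fderiv_isBigO_of_isBigO hFs.contDiffAt (isBigO_of_mem_homPoly hF _))
  have hdXO : fderiv ℝ X =O[𝓝 0] fun y : V => ‖y‖ ^ (n + 1) :=
    fderiv_isBigO_of_isBigO hXs.contDiffAt hXO
  have hX0 : X 0 = 0 := by
    obtain ⟨C, hC⟩ := hXO.bound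
    simpa using hC.self_of_nhds
  have hdX0 : fderiv ℝ X 0 = 0 := by
    obtain ⟨C, hC⟩ := hdXO.bound
    simpa using hC.self_of_nhds
  let m : ℝ → V → V := fun t z => z + t • X z
  have hms : ∀ t, ContDiff ℝ (⊤ : ℕ∞) (m t) := fun t => contDiff_id.add (hXs.const_smul t)
  have hmd : ∀ t z, fderiv ℝ (m t) z = ContinuousLinearMap.id ℝ V + t • fderiv ℝ X z := by
    intro t z
    exact ((hasFDerivAt_id z).add ((hXd z).hasFDerivAt.const_smul t)).fderiv
  have hm1 : ∀ t, fderiv ℝ (m t) 0 = ContinuousLinearMap.id ℝ V := fun t => by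
    rw [hmd, hdX0, smul_zero, add_zero]
  have hm0 : ∀ t, m t 0 = 0 := fun t => by simp [m, hX0]
  have hskew : ∀ z u v, ω (fderiv ℝ X z u) v = - ω u (fderiv ℝ X z v) := by
    intro z u v
    rw [omega_fderiv_hamVF hFs.contDiffAt, isSymmSndFDerivAt_of_smooth hFs.contDiffAt,
      ← omega_fderiv_hamVF (ω := ω) (hω := hω) hFs.contDiffAt, ← hωalt.neg_eq, ← hX]
  have hmω : ∀ t z u v, ω (fderiv ℝ (m t) z u) (fderiv ℝ (m t) z v) =
      ω u v + t ^ 2 * ω (fderiv ℝ X z u) (fderiv ℝ X z v) := by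
    intro t z u v
    simp [hmd, hskew]
    ring
  obtain ⟨φ, hφ, hφ0, hφs⟩ := exists_local_inverse (hms (-(1 / 2))) (hm1 _)
  obtain ⟨ψ, hψ, hψ0, -⟩ := exists_local_inverse (hms (1 / 2)) (hm1 _)
  -- The domain of `ψ` enters only to make `m (1 / 2)` injective at the midpoints.
  let U : Set V := φ.target ∩ φ.symm ⁻¹' ψ.source
  let ξ : V → V := fun y => m (1 / 2) (φ.symm y)
  have hg0 : φ.symm 0 = 0 := by
    have := φ.left_inv hφ0
    rwa [hφ, hm0] at this
  have hUopen : IsOpen U := φ.symm.isOpen_inter_preimage ψ.open_source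
  have hU0 : (0 : V) ∈ U := by
    refine ⟨?_, ?_⟩
    · have := φ.map_source hφ0
      rwa [hφ, hm0] at this
    · change φ.symm 0 ∈ ψ.source
      rwa [hg0]
  have hgs : ∀ y ∈ U, ContDiffAt ℝ (⊤ : ℕ∞) φ.symm y := fun y hy => by
    have := (hφs _ (φ.map_target hy.1)).1
    rwa [← hφ, φ.right_inv hy.1] at this
  have hξs : ∀ y ∈ U, ContDiffAt ℝ (⊤ : ℕ∞) ξ y := fun y hy =>
    (hms _).contDiffAt.comp y (hgs y hy)
  have hchain : ∀ y ∈ U, (fderiv ℝ ξ y).comp (fderiv ℝ (m (-(1 / 2))) (φ.symm y)) =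
      fderiv ℝ (m (1 / 2)) (φ.symm y) := by
    intro y hy
    have hz : φ.symm y ∈ φ.source := φ.map_target hy.1
    have hy' : m (-(1 / 2)) (φ.symm y) = y := by rw [← hφ]; exact φ.right_inv hy.1
    have h1 : HasFDerivAt (m (-(1 / 2))) (fderiv ℝ (m (-(1 / 2))) (φ.symm y)) (φ.symm y) :=
      ((hms _).differentiable (by simp) _).hasFDerivAt
    have h2 : HasFDerivAt ξ (fderiv ℝ ξ y) (m (-(1 / 2)) (φ.symm y)) := by
      rw [hy']
      exact ((hξs y hy).differentiableAt (by simp)).hasFDerivAt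
    have h3 : (fun z => ξ (m (-(1 / 2)) z)) =ᶠ[𝓝 (φ.symm y)] m (1 / 2) := by
      filter_upwards [φ.open_source.mem_nhds hz] with z hz
      change m (1 / 2) (φ.symm (m (-(1 / 2)) z)) = _
      rw [← hφ, φ.left_inv hz]
    rw [← h3.fderiv_eq]
    exact (h2.comp _ h1).fderiv.symm
  have hsymp : ∀ y ∈ U, ∀ u v, ω (fderiv ℝ ξ y u) (fderiv ℝ ξ y v) = ω u v := by
    intro y hy u v
    have hsurj := (hφs _ (φ.map_target hy.1)).2
    obtain ⟨u, rfl⟩ := hsurj u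
    obtain ⟨v, rfl⟩ := hsurj v
    rw [← ContinuousLinearMap.comp_apply, ← ContinuousLinearMap.comp_apply, hchain y hy, hmω, hmω,
      neg_sq]
  have hfd0 : fderiv ℝ ξ 0 = ContinuousLinearMap.id ℝ V := by
    have := hchain 0 hU0
    rwa [hg0, hm1, hm1, ContinuousLinearMap.comp_id] at this
  have hgO : (φ.symm : V → V) =O[𝓝 0] fun y => y := by
    have := ((hgs 0 hU0).differentiableAt (by simp)).isBigO_sub
    simpa [hg0] using this
  have hev : ∀ᶠ y in 𝓝 (0 : V), m (-(1 / 2)) (φ.symm y) = y := by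
    filter_upwards [hUopen.mem_nhds hU0] with y hy
    rw [← hφ]
    exact φ.right_inv hy.1
  refine ⟨U, ξ, ⟨hUopen, hU0, fun y hy => (hξs y hy).contDiffWithinAt, ?_, ?_, hfd0, hsymp⟩,
    ?_, ?_⟩
  · intro y hy y' hy' h
    have h1 : φ.symm y = φ.symm y' := ψ.injOn hy.2 hy'.2 (by rw [hψ]; exact h)
    exact φ.symm.injOn hy.1 hy'.1 h1
  · change m (1 / 2) (φ.symm 0) = 0
    rw [hg0, hm0]
  · have hdiff : (fun y => φ.symm y - y) =O[𝓝 0] fun y : V => ‖y‖ ^ (n + 2) := by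
      have h1 : (fun y => X (φ.symm y)) =O[𝓝 0] fun y : V => ‖y‖ ^ (n + 2) := by
        have hlim : Tendsto φ.symm (𝓝 0) (𝓝 0) := by
          have := (hgs 0 hU0).continuousAt.tendsto
          rwa [hg0] at this
        exact (hXO.comp_tendsto hlim).trans (hgO.norm_norm.pow _)
      refine (h1.const_smul_left (1 / 2 : ℝ)).congr' ?_ EventuallyEq.rfl
      filter_upwards [hev] with y hy
      calc (1 / 2 : ℝ) • X (φ.symm y) = φ.symm y - m (-(1 / 2)) (φ.symm y) := by
            simp [m]
        _ = φ.symm y - y := by rw [hy]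
    -- The error is `X_F(z) - X_F(y)`, of order `(k - 2) + (k - 1)`, and this is at least `k`
    -- because `k ≥ 3`.
    have h1 := (isBigO_comp_sub_comp (Eventually.of_forall hXd) hdXO hgO (isBigO_refl _ _)).trans
      ((isBigO_refl (fun y : V => ‖y‖ ^ (n + 1)) _).mul hdiff.norm_left)
    simp only [← pow_add] at h1
    refine (h1.congr' ?_ EventuallyEq.rfl).trans (norm_pow_isBigO_norm_pow (by omega))
    filter_upwards [hev] with y hy
    calc X (φ.symm y) - X y = m (1 / 2) (φ.symm y) - m (-(1 / 2)) (φ.symm y) - X y := by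
          simp only [m]
          module
      _ = ξ y - y - X y := by rw [hy]
  · intro e he
    have hem : ∀ t z, m t (e z) = e (m t z) := fun t z => by simp [m, he]
    have hlim : Tendsto (fun y => e (φ.symm y)) (𝓝 0) (𝓝 0) := by
      have := (e.continuous.continuousAt.comp (hgs 0 hU0).continuousAt).tendsto
      simpa [Function.comp_def, hg0] using this
    filter_upwards [hev, hlim.eventually (φ.open_source.mem_nhds hφ0)] with y hy hey
    have h1 : φ.symm (e y) = e (φ.symm y) := by
      have h := φ.left_inv hey
      rwa [hφ, hem, hy] at h
    change m (1 / 2) (φ.symm (e y)) = e (m (1 / 2) (φ.symm y))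
    rw [h1, hem]

end Midpoint

/-! ### Equivariant splitting of homogeneous polynomials -/

section Splitting

variable {V : Type*} [NormedAddCommGroup V] [InnerProductSpace ℝ V]

/-- The pull-back `F ↦ F ∘ A` of homogeneous polynomials. -/
def pullback (A : V →L[ℝ] V) (k : ℕ) : homPoly V k →ₗ[ℝ] homPoly V k where
  toFun F := ⟨fun x => (F : V → ℝ) (A x), by
    obtain ⟨M, hM⟩ := F.2
    exact ⟨M.compContinuousLinearMap fun _ => A, fun x => hM (A x)⟩⟩
  map_add' F G := rfl
  map_smul' c F := rfl

theorem coe_units_smul {k : ℕ} (c : ℤˣ) (F : homPoly V k) (x : V) :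
    ((c • F : homPoly V k) : V → ℝ) x = c • (F : V → ℝ) x := by
  rcases Int.units_eq_one_or c with rfl | rfl
  · simp
  · simp [Units.neg_smul]

theorem linearMap_units_smul {W : Type*} [AddCommGroup W] [Module ℝ W] (f : W →ₗ[ℝ] W) (c : ℤˣ)
    (w : W) : f (c • w) = c • f w := by
  rcases Int.units_eq_one_or c with rfl | rfl
  · simp
  · simp [Units.neg_smul]

theorem lieDer_pullback {A : GLin V} {L : V →L[ℝ] V} {c : ℤˣ}
    (h : ∀ x, (A : V →L[ℝ] V) (L x) = c • L ((A : V →L[ℝ] V) x)) {k : ℕ} (F : homPoly V k) :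
    lieDer L k (pullback (A : V →L[ℝ] V) k F) = c • pullback (A : V →L[ℝ] V) k (lieDer L k F) := by
  ext x
  rw [coe_units_smul, lieDer_apply]
  change fderiv ℝ (fun y => (F : V → ℝ) ((A : V →L[ℝ] V) y)) x (L x) =
    c • fderiv ℝ F ((A : V →L[ℝ] V) x) (L ((A : V →L[ℝ] V) x))
  rw [fderiv_comp_unit, h]
  rcases Int.units_eq_one_or c with rfl | rfl
  · simp
  · simp [Units.neg_smul]

theorem eq_zero_of_mem_homPoly_of_isBigO {k : ℕ} {F : V → ℝ} (hF : F ∈ homPoly V k)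
    (h : F =O[𝓝 0] fun y => ‖y‖ ^ (k + 1)) : F = 0 := by
  obtain ⟨M, hM⟩ := hF
  rw [funext hM] at h ⊢
  exact funext fun x => diagonal_eq_zero_of_isBigO h x

variable [FiniteDimensional ℝ V]

/-- Pull-back by `g` commutes up to the sign `σ₂(g)` with the Lie derivatives along `L` and, by
orthogonality, along `Lᵀ`, so it respects their kernels and ranges. Uniqueness of the splitting then
forces the symmetry; `F` receives the sign `σ₁σ₂ · σ₂ = σ₁`. -/
theorem exists_equivariant_splitting {G : Type*} [Group G] {ρ : G →* GLin V} {σ₁ σ₂ : G →* ℤˣ}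
    (hρ : IsOrthogonal ρ) {X : V → V} (hX : IsEquivariant ρ σ₂ X) {k : ℕ} (Q : homPoly V k)
    (hQ : ∀ g, pullback (ρ g : V →L[ℝ] V) k Q = (σ₁ g * σ₂ g) • Q) :
    ∃ P F : homPoly V k,
      lieDer (ContinuousLinearMap.adjoint (fderiv ℝ X 0)) k P = 0 ∧
      Q = P + lieDer (fderiv ℝ X 0) k F ∧
      (∀ g, pullback (ρ g : V →L[ℝ] V) k P = (σ₁ g * σ₂ g) • P) ∧
      ∀ g, pullback (ρ g : V →L[ℝ] V) k F = σ₁ g • F := by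
  set L := fderiv ℝ X 0 with hL
  have hcL : ∀ g x, (ρ g : V →L[ℝ] V) (L x) = σ₂ g • L ((ρ g : V →L[ℝ] V) x) := by
    intro g x
    have h := congrArg (fun T : V →L[ℝ] V => σ₂ g • T x) (linearization_comp hX g)
    rcases Int.units_eq_one_or (σ₂ g) with hc | hc
    · simpa [hc, hL] using h.symm
    · simpa [hc, hL, Units.neg_smul] using h.symm
  have hcT : ∀ g x, (ρ g : V →L[ℝ] V) (ContinuousLinearMap.adjoint L x) =
      σ₂ g • ContinuousLinearMap.adjoint L ((ρ g : V →L[ℝ] V) x) := by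
    intro g x
    have h := congrArg (fun T : V →L[ℝ] V => (T * (ρ g : V →L[ℝ] V)) x) (transpose_comp hρ hX g)
    simp only [mul_assoc, Units.inv_mul, mul_one] at h
    rcases Int.units_eq_one_or (σ₂ g) with hc | hc
    · simpa [hc, hL] using h
    · simpa [hc, hL, Units.neg_smul] using h
  obtain ⟨P, F₀, hP, hQP⟩ := exists_eq_add_lieDer L Q
  -- Only the component of `F₀` in the range of the Lie derivative along `Lᵀ` is kept; the rest is
  -- annihilated by the Lie derivative along `L`. This makes the solution unique.
  obtain ⟨F₁, F₂, hF₁, hF₀⟩ := exists_eq_add_lieDer (ContinuousLinearMap.adjoint L) F₀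
  rw [ContinuousLinearMap.adjoint_adjoint] at hF₁
  set T := lieDer (ContinuousLinearMap.adjoint L) k with hT
  have hQF : Q = P + lieDer L k (T F₂) := by
    rw [hQP, hF₀, map_add, hF₁, zero_add]
  have key : ∀ g, pullback (ρ g : V →L[ℝ] V) k P = (σ₁ g * σ₂ g) • P ∧
      pullback (ρ g : V →L[ℝ] V) k (T F₂) = σ₁ g • T F₂ := by
    intro g
    set R := pullback (ρ g : V →L[ℝ] V) k with hR
    have hRL : ∀ F, lieDer L k (R F) = σ₂ g • R (lieDer L k F) := lieDer_pullback (hcL g)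
    have hRT : ∀ F, T (R F) = σ₂ g • R (T F) := lieDer_pullback (hcT g)
    have hss : ∀ (c : ℤˣ) (F : homPoly V k), c • c • F = F := fun c F => by
      rw [smul_smul, ← sq, Int.units_sq, one_smul]
    -- `P'` and `T W` measure the failure of symmetry of `P` and, up to `σ₂(g)`, of `T F₂`. They
    -- satisfy `P' + lieDer L k (T W) = 0` with `T P' = 0`, so orthogonality makes both vanish.
    let P' := R P - (σ₁ g * σ₂ g) • P
    let W := R F₂ - (σ₁ g * σ₂ g) • F₂
    have hTP : T P' = 0 := by
      simp only [P', map_sub, hRT, hP, linearMap_units_smul, map_zero, smul_zero, sub_zero]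
    have hTW : T W = σ₂ g • R (T F₂) - (σ₁ g * σ₂ g) • T F₂ := by
      simp only [W, map_sub, hRT, linearMap_units_smul]
    have hsum : P' + lieDer L k (T W) = 0 := by
      have h1 := hQ g
      rw [hQF, map_add, smul_add] at h1
      rw [hTW, map_sub, linearMap_units_smul, linearMap_units_smul, hRL, hss]
      simp only [P']
      rw [sub_add_sub_comm, h1, sub_self]
    have hLW : lieDer L k (T W) = 0 := by
      refine lieDer_eq_zero_of_lieDer_adjoint ?_
      have := congrArg T hsum
      rwa [map_add, hTP, zero_add, map_zero] at this
    have hW0 : T W = 0 := by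
      refine lieDer_eq_zero_of_lieDer_adjoint ?_
      rw [ContinuousLinearMap.adjoint_adjoint]
      exact hLW
    rw [hLW, add_zero] at hsum
    refine ⟨sub_eq_zero.1 hsum, ?_⟩
    rw [hTW, sub_eq_zero] at hW0
    rw [← hss (σ₂ g) (R (T F₂)), hW0, smul_smul, mul_comm (σ₁ g), ← mul_assoc, ← sq,
      Int.units_sq, one_mul]
  exact ⟨P, T F₂, hP, hQF, fun g => (key g).1, fun g => (key g).2⟩

end Splitting

/-! ### The normal form -/

section NormalForm

open Asymptotics Filter

variable {V : Type*} [NormedAddCommGroup V] [InnerProductSpace ℝ V]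
  {ω : LinearMap.BilinForm ℝ V}

theorem IsSymplecticChange.contDiffAt {U : Set V} {ξ : V → V} (h : IsSymplecticChange ω U ξ)
    {y : V} (hy : y ∈ U) : ContDiffAt ℝ (⊤ : ℕ∞) ξ y :=
  h.smooth.contDiffAt (h.isOpen.mem_nhds hy)

theorem IsSymplecticChange.differentiableAt {U : Set V} {ξ : V → V}
    (h : IsSymplecticChange ω U ξ) {y : V} (hy : y ∈ U) : DifferentiableAt ℝ ξ y :=
  (h.contDiffAt hy).differentiableAt (by simp)

theorem IsSymplecticChange.tendsto {U : Set V} {ξ : V → V} (h : IsSymplecticChange ω U ξ) :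
    Tendsto ξ (𝓝 0) (𝓝 0) := by
  have := (h.contDiffAt h.zero_mem).continuousAt.tendsto
  rwa [h.map_zero] at this

theorem IsSymplecticChange.isBigO_id {U : Set V} {ξ : V → V} (h : IsSymplecticChange ω U ξ) :
    ξ =O[𝓝 0] fun y => y := by
  simpa [h.map_zero] using (h.differentiableAt h.zero_mem).isBigO_sub

theorem isSymplecticChange_id (ω : LinearMap.BilinForm ℝ V) :
    IsSymplecticChange ω Set.univ id where
  isOpen := isOpen_univ
  zero_mem := trivial
  smooth := contDiff_id.contDiffOn
  injOn := Function.injective_id.injOn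
  map_zero := rfl
  fderiv_zero := fderiv_id
  symplectic y _ u v := by rw [fderiv_id]; rfl

theorem IsSymplecticChange.comp {U W : Set V} {ξ η : V → V} (hξ : IsSymplecticChange ω U ξ)
    (hη : IsSymplecticChange ω W η) : IsSymplecticChange ω (W ∩ η ⁻¹' U) (ξ ∘ η) where
  isOpen := hη.smooth.continuousOn.isOpen_inter_preimage hη.isOpen hξ.isOpen
  zero_mem := ⟨hη.zero_mem, by
    change η 0 ∈ U
    rw [hη.map_zero]
    exact hξ.zero_mem⟩
  smooth := hξ.smooth.comp (hη.smooth.mono Set.inter_subset_left) fun _ h => h.2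
  injOn y hy y' hy' h := hη.injOn hy.1 hy'.1 (hξ.injOn hy.2 hy'.2 h)
  map_zero := by rw [Function.comp_apply, hη.map_zero, hξ.map_zero]
  fderiv_zero := by
    have h1 := hξ.differentiableAt hξ.zero_mem
    rw [← hη.map_zero] at h1
    rw [fderiv_comp 0 h1 (hη.differentiableAt hη.zero_mem), hη.map_zero, hξ.fderiv_zero,
      hη.fderiv_zero, ContinuousLinearMap.comp_id]
  symplectic y hy u v := by
    rw [fderiv_comp y (hξ.differentiableAt hy.2) (hη.differentiableAt hy.1)]
    exact (hξ.symplectic _ hy.2 _ _).trans (hη.symplectic _ hy.1 _ _)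

/-- The effect of a change of coordinates close to the time-one map of `X_F` on a function with
quadratic part `B x x`. -/
theorem comp_sub_sub_isBigO {n : ℕ} (hn : 3 ≤ n) {D : V → ℝ} (hD : ContDiffAt ℝ (⊤ : ℕ∞) D 0)
    (hD3 : D =O[𝓝 0] fun y => ‖y‖ ^ 3) (B : V →L[ℝ] V →L[ℝ] ℝ) {Y η : V → V}
    (hη : η =O[𝓝 0] fun y => y) (hY : Y =O[𝓝 0] fun y => ‖y‖ ^ (n - 1))
    (hηY : (fun y => η y - y - Y y) =O[𝓝 0] fun y => ‖y‖ ^ n) :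
    (fun y => B (η y) (η y) + D (η y) - (B y y + D y) - (B y (Y y) + B (Y y) y)) =O[𝓝 0]
      fun y => ‖y‖ ^ (n + 1) := by
  have hdiff : (fun y => η y - y) =O[𝓝 0] fun y => ‖y‖ ^ (n - 1) :=
    ((hηY.trans (norm_pow_isBigO_norm_pow (by omega))).add hY).congr_left fun y => by abel
  have hDη : (fun y => D (η y) - D y) =O[𝓝 0] fun y => ‖y‖ ^ (n + 1) := by
    have hev : ∀ᶠ y in 𝓝 (0 : V), DifferentiableAt ℝ D y := by
      have : ContDiffAt ℝ 1 D 0 := hD.of_le (by norm_cast)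
      filter_upwards [this.eventually (by simp)] with y hy
      exact hy.differentiableAt one_ne_zero
    refine ((isBigO_comp_sub_comp hev (fderiv_isBigO_of_isBigO hD hD3) hη
      (isBigO_refl _ _)).trans ((isBigO_refl _ _).mul hdiff.norm_left)).congr_right fun y => ?_
    rw [← pow_add]
    congr 1
    omega
  have hB : ∀ {u v : V → V} {a b : ℕ}, u =O[𝓝 0] (fun y : V => ‖y‖ ^ a) →
      v =O[𝓝 0] (fun y : V => ‖y‖ ^ b) → n + 1 ≤ a + b →
      (fun y => B (u y) (v y)) =O[𝓝 0] fun y => ‖y‖ ^ (n + 1) := by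
    intro u v a b hu hv hab
    refine IsBigO.trans (IsBigO.of_bound ‖B‖ (Eventually.of_forall fun y => ?_))
      ((hu.norm_left.mul hv.norm_left).trans
        ((norm_pow_isBigO_norm_pow hab).congr_left fun y => pow_add _ _ _))
    rw [norm_mul, norm_norm, norm_norm, ← mul_assoc]
    exact B.le_opNorm₂ _ _
  have hid : (fun y : V => y) =O[𝓝 0] fun y : V => ‖y‖ ^ 1 := by
    simpa using (isBigO_refl (fun y : V => y) (𝓝 0)).norm_right
  -- Writing `η = y + (η - y)`, the remainder is `D(η) - D(y)`, the pairings of `y` with `η - y -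
  -- Y`, and a square of order `2(n - 1) ≥ n + 1`, where `n ≥ 3` is needed.
  refine (((hDη.add (hB hid hηY (by omega))).add (hB hηY hid (by omega))).add
    (hB hdiff hdiff (by omega))).congr_left fun y => ?_
  simp only [map_sub, sub_apply]
  ring

theorem contDiff_quadPart_add_sum (H : V → ℝ) {P : ℕ → V → ℝ} (s : Finset ℕ)
    (hP : ∀ k, P k ∈ homPoly V k) {m : WithTop ℕ∞} :
    ContDiff ℝ m (quadPart H + ∑ k ∈ s, P k) := by
  refine (contDiff_of_mem_homPoly (quadPart_mem_homPoly H)).add ?_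
  have : ContDiff ℝ m fun y => ∑ k ∈ s, P k y :=
    ContDiff.sum fun k _ => contDiff_of_mem_homPoly (hP k)
  convert this using 1
  funext y
  rw [Finset.sum_apply]

variable [FiniteDimensional ℝ V]

/-- The derivative preserves the non-degenerate `ω`, so it is injective, hence onto by dimension,
and the vector field pulled back by it satisfies the defining equation for `H ∘ ξ`. -/
theorem IsSymplecticChange.fderiv_hamVF_comp {U : Set V} {ξ : V → V}
    (h : IsSymplecticChange ω U ξ) (hω : ω.Nondegenerate) {H : V → ℝ} (hH : Differentiable ℝ H)
    {y : V} (hy : y ∈ U) :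
    fderiv ℝ ξ y (hamVF ω hω (H ∘ ξ) y) = hamVF ω hω H (ξ y) := by
  have hinj : Function.Injective (fderiv ℝ ξ y) := fun u v huv =>
    eq_of_omega_eq hω fun w => by
      rw [← h.symplectic y hy, huv, h.symplectic y hy]
  obtain ⟨w, hw⟩ := LinearMap.injective_iff_surjective (f := (fderiv ℝ ξ y : V →ₗ[ℝ] V)).1 hinj
    (hamVF ω hω H (ξ y))
  have hw : fderiv ℝ ξ y w = hamVF ω hω H (ξ y) := hw
  have : hamVF ω hω (H ∘ ξ) y = w := eq_of_omega_eq hω fun v => by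
    rw [hamVF_spec, fderiv_comp y (hH _) (h.differentiableAt hy), ContinuousLinearMap.comp_apply,
      ← hamVF_spec ω hω, ← hw, h.symplectic y hy]
  rw [this, hw]

theorem quadPart_semiinvariant {hω : ω.Nondegenerate} {G : Type*} [Group G] {ρ : G →* GLin V}
    {σ₁ σ₂ : G →* ℤˣ} (hρω : IsSemisymplectic ω ρ σ₁) {H : V → ℝ}
    (hH : ContDiffAt ℝ (⊤ : ℕ∞) H 0) (hX : IsEquivariant ρ σ₂ (hamVF ω hω H)) (g : G) (x : V) :
    quadPart H ((ρ g : V →L[ℝ] V) x) = (σ₁ g * σ₂ g) • quadPart H x := by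
  refine semiinvariant_of_hamVF_equivariant (hω := hω) hρω
    (differentiable_of_mem_homPoly (quadPart_mem_homPoly H)) (by simp [quadPart])
    (fun g x => ?_) g x
  have h := congrArg (fun T : V →L[ℝ] V => T x) (linearization_comp hX g)
  rw [hamVF_quadPart hH, hamVF_quadPart hH]
  rcases Int.units_eq_one_or (σ₂ g) with hc | hc
  · simpa [hc] using h
  · simpa [hc, Units.neg_smul] using h

theorem hamVF_sub_hamVF_isBigO (hω : ω.Nondegenerate) {F G : V → ℝ} {m : ℕ}
    (hF : ContDiffAt ℝ (⊤ : ℕ∞) F 0) (hG : ContDiffAt ℝ (⊤ : ℕ∞) G 0)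
    (h : (fun y => F y - G y) =O[𝓝 0] fun y => ‖y‖ ^ (m + 1)) :
    (fun y => hamVF ω hω F y - hamVF ω hω G y) =O[𝓝 0] fun y => ‖y‖ ^ m := by
  have hdiff : ∀ {E : V → ℝ}, ContDiffAt ℝ (⊤ : ℕ∞) E 0 →
      ∀ᶠ y in 𝓝 (0 : V), DifferentiableAt ℝ E y := fun hE => by
    have h1 := hE.of_le (m := 1) (by norm_cast)
    filter_upwards [h1.eventually (by simp)] with y hy
    exact hy.differentiableAt one_ne_zero
  refine (((dualToVec ω hω).isBigO_comp _ _).trans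
    (fderiv_isBigO_of_isBigO (hF.sub hG) h)).congr' ?_ EventuallyEq.rfl
  filter_upwards [hdiff hF, hdiff hG] with y h1 h2
  simp only [hamVF_eq_dualToVec]
  rw [← map_sub, ← fderiv_fun_sub h1 h2]

/-- The data of a normal form of order `n + 2`, together with its symmetries. -/
theorem exists_semiinvariant_normalForm (hωalt : ω.IsAlt) (hω : ω.Nondegenerate)
    {G : Type*} [Group G] {ρ : G →* GLin V} {σ₁ σ₂ : G →* ℤˣ}
    (hρo : IsOrthogonal ρ) (hρω : IsSemisymplectic ω ρ σ₁)
    {H : V → ℝ} (hH : ContDiff ℝ (⊤ : ℕ∞) H) (hH0 : H 0 = 0)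
    (hX0 : hamVF ω hω H 0 = 0) (hX : IsEquivariant ρ σ₂ (hamVF ω hω H)) (n : ℕ) :
    ∃ (P : ℕ → V → ℝ) (U : Set V) (ξ : V → V),
      (∀ k, P k ∈ homPolyInv (groupS (fderiv ℝ (hamVF ω hω H) 0)).subtype 1 k ∧
        ∀ g x, P k ((ρ g : V →L[ℝ] V) x) = (σ₁ g * σ₂ g) • P k x) ∧
      IsSymplecticChange ω U ξ ∧
      (∀ g, ∀ᶠ y in 𝓝 0, ξ ((ρ g : V →L[ℝ] V) y) = (ρ g : V →L[ℝ] V) (ξ y)) ∧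
      (fun y => H (ξ y) - (quadPart H + ∑ k ∈ Finset.Icc 3 (n + 2), P k) y) =O[𝓝 0]
        fun y => ‖y‖ ^ (n + 3) := by
  set L := fderiv ℝ (hamVF ω hω H) 0 with hL
  have hHinv : ∀ g x, H ((ρ g : V →L[ℝ] V) x) = (σ₁ g * σ₂ g) • H x :=
    semiinvariant_of_hamVF_equivariant hρω (hH.differentiable (by simp)) hH0 hX
  have hQinv : ∀ g x, quadPart H ((ρ g : V →L[ℝ] V) x) = (σ₁ g * σ₂ g) • quadPart H x :=
    quadPart_semiinvariant hρω hH.contDiffAt hX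
  induction n with
  | zero =>
    refine ⟨0, Set.univ, id, fun k => ⟨zero_mem _, fun g x => by simp⟩, isSymplecticChange_id ω,
      fun g => Eventually.of_forall fun y => rfl, ?_⟩
    have hd0 : fderiv ℝ H 0 = 0 := by
      ext v
      rw [← hamVF_spec ω hω, hX0]
      simp
    have hflat : ∀ j < 2, iteratedFDeriv ℝ j H 0 = 0 := by
      intro j hj
      interval_cases j
      · ext v; simpa using hH0
      · ext v; simp [hd0]
    simpa [quadPart_eq_taylorTerm] using sub_taylorTerm_isBigO hH.contDiffAt hflat
  | succ n ih =>
    obtain ⟨P, U, ξ, hP, hξ, hξρ, hO⟩ := ih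
    set K := quadPart H + ∑ k ∈ Finset.Icc 3 (n + 2), P k with hK
    have hsum3 : (∑ k ∈ Finset.Icc 3 (n + 2), P k) =O[𝓝 0] fun y : V => ‖y‖ ^ 3 := by
      exact IsBigO.sum fun k hk => (isBigO_of_mem_homPoly (hP k).1.1 _).trans
        (norm_pow_isBigO_norm_pow (Finset.mem_Icc.1 hk).1)
    have hKs : ContDiff ℝ (⊤ : ℕ∞) K := contDiff_quadPart_add_sum H _ fun k => (hP k).1.1
    have hKinv : ∀ g x, K ((ρ g : V →L[ℝ] V) x) = (σ₁ g * σ₂ g) • K x := by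
      intro g x
      simp only [hK, Pi.add_apply, Finset.sum_apply, smul_add, Finset.smul_sum, hQinv, (hP _).2]
    have hHξ : ContDiffAt ℝ (⊤ : ℕ∞) (H ∘ ξ) 0 := hH.contDiffAt.comp 0 (hξ.contDiffAt hξ.zero_mem)
    let R : V → ℝ := fun y => H (ξ y) - K y
    have hRs : ContDiffAt ℝ (⊤ : ℕ∞) R 0 := hHξ.sub hKs.contDiffAt
    have hR := sub_taylorTerm_isBigO hRs (iteratedFDeriv_eq_zero_of_isBigO hRs hO)
    let Q : homPoly V (n + 3) := ⟨taylorTerm R (n + 3), taylorTerm_mem_homPoly _ _⟩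
    have hQ : ∀ g, pullback (ρ g : V →L[ℝ] V) (n + 3) Q = (σ₁ g * σ₂ g) • Q := by
      intro g
      rw [← sub_eq_zero]
      -- The remainder `R` is semi-invariant near the origin, so the defect of its leading term `Q`
      -- is `O(|y|ⁿ⁺⁴)`; it is homogeneous of degree `n + 3`, hence zero.
      refine Subtype.ext (eq_zero_of_mem_homPoly_of_isBigO (Subtype.prop _) ?_)
      have hRinv : ∀ᶠ y in 𝓝 (0 : V), R ((ρ g : V →L[ℝ] V) y) = (σ₁ g * σ₂ g) • R y := by
        filter_upwards [hξρ g] with y hy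
        simp only [R, hy, hHinv, hKinv, smul_sub]
      have hlim : Tendsto (ρ g : V →L[ℝ] V) (𝓝 0) (𝓝 0) := by
        simpa using (ρ g : V →L[ℝ] V).continuous.tendsto 0
      have h1 : (fun y => R ((ρ g : V →L[ℝ] V) y) -
          taylorTerm R (n + 3) ((ρ g : V →L[ℝ] V) y)) =O[𝓝 0] fun y => ‖y‖ ^ (n + 3 + 1) :=
        (hR.comp_tendsto hlim).trans
          ((((ρ g : V →L[ℝ] V).isBigO_id (𝓝 0)).norm_norm).pow _)
      have h2 : (fun y => (σ₁ g * σ₂ g) • (R y - taylorTerm R (n + 3) y)) =O[𝓝 0]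
          fun y => ‖y‖ ^ (n + 3 + 1) := by
        refine (hR.norm_left.congr_left fun y => ?_).of_norm_left
        rcases Int.units_eq_one_or (σ₁ g * σ₂ g) with hc | hc
        · simp [hc]
        · rw [hc, Units.neg_smul, one_smul, norm_neg]
      refine (h2.sub h1).congr' ?_ EventuallyEq.rfl
      filter_upwards [hRinv] with y hy
      rw [Submodule.coe_sub, Pi.sub_apply, coe_units_smul, hy, smul_sub]
      change _ = taylorTerm R (n + 3) ((ρ g : V →L[ℝ] V) y) -
        (σ₁ g * σ₂ g) • taylorTerm R (n + 3) y
      abel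
    obtain ⟨P', F, hP', hQPF, hP'inv, hFinv⟩ := exists_equivariant_splitting hρo hX Q hQ
    obtain ⟨W, η, hη, hηF, hηe⟩ := exists_symplecticChange ω hωalt hω (by omega) F.2
    refine ⟨Function.update P (n + 3) P', W ∩ η ⁻¹' U, ξ ∘ η, ?_, hξ.comp hη, ?_, ?_⟩
    · intro k
      by_cases hk : k = n + 3
      · subst hk
        rw [Function.update_self]
        refine ⟨(mem_homPolyInv_groupS_iff L).2 ⟨P'.2, hP'⟩, fun g x => ?_⟩
        rw [← coe_units_smul, ← hP'inv g]
        rfl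
      · rw [Function.update_of_ne hk]
        exact hP k
    · intro g
      have hF : ∀ x, (F : V → ℝ) ((ρ g : V →L[ℝ] V) x) = σ₁ g • (F : V → ℝ) x := fun x => by
        rw [← coe_units_smul, ← hFinv g]
        rfl
      filter_upwards [hηe (ρ g) fun x => by
        rw [hamVF_apply_of_semiinvariant hρω hF, ← sq, Int.units_sq, one_smul],
        hη.tendsto.eventually (hξρ g)] with y h1 h2
      rw [Function.comp_apply, h1, h2]
      rfl
    · let D : V → ℝ := fun y => H (ξ y) - quadPart H y
      have hDs : ContDiffAt ℝ (⊤ : ℕ∞) D 0 :=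
        hHξ.sub (contDiff_of_mem_homPoly (quadPart_mem_homPoly H)).contDiffAt
      have hD3 : D =O[𝓝 0] fun y => ‖y‖ ^ 3 := by
        refine ((hO.trans (norm_pow_isBigO_norm_pow (by omega))).add hsum3).congr_left fun y => ?_
        simp only [hK, D, Pi.add_apply]
        ring
      have hFO : hamVF ω hω F =O[𝓝 0] fun y => ‖y‖ ^ (n + 3 - 1) :=
        ((dualToVec ω hω).isBigO_comp _ _).trans
          (fderiv_isBigO_of_isBigO (contDiff_of_mem_homPoly F.2).contDiffAt
            (isBigO_of_mem_homPoly F.2 _))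
      have h1 := comp_sub_sub_isBigO (by omega) hDs hD3
        ((1 / 2 : ℝ) • fderiv ℝ (fderiv ℝ H) 0) hη.isBigO_id hFO hηF
      refine (h1.add hR).congr_left fun y => ?_
      -- Here is the homological equation: `d²H₀(y, X_F) = ω(L y, X_F) = -dF(L y)`, so `η` with
      -- `+X_F` cancels the range part of `Q`.
      have h2 : fderiv ℝ (fderiv ℝ H) 0 y (hamVF ω hω F y) = - fderiv ℝ F y (L y) := by
        rw [← omega_fderiv_hamVF (hω := hω) hH.contDiffAt, ← hωalt.neg_eq, hamVF_spec]
      have h3 : fderiv ℝ (fderiv ℝ H) 0 (hamVF ω hω F y) y = - fderiv ℝ F y (L y) := by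
        rw [isSymmSndFDerivAt_of_smooth hH.contDiffAt, h2]
      have h4 : taylorTerm R (n + 3) y = (P' : V → ℝ) y + fderiv ℝ F y (L y) :=
        congrFun (congrArg Subtype.val hQPF) y
      have h5 : (∑ k ∈ Finset.Icc 3 (n + 1 + 2), Function.update P (n + 3) (P' : V → ℝ) k) =
          ∑ k ∈ Finset.Icc 3 (n + 2), P k + (P' : V → ℝ) := by
        refine (Finset.sum_Icc_succ_top (b := n + 2) (by omega) _).trans
          (congrArg₂ (· + ·) (Finset.sum_congr rfl fun k hk => Function.update_of_ne ?_ _ _)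
            (Function.update_self _ _ _))
        have := (Finset.mem_Icc.1 hk).2
        omega
      rw [h4, h5]
      simp only [D, R, hK, quadPart, Pi.add_apply, Function.comp_apply, smul_apply, h2, h3,
        smul_eq_mul]
      ring

end NormalForm

end HamNF

end

open HamNF in
theorem mainTheorem4
    -- the symplectic vector space
    {V : Type*} [NormedAddCommGroup V] [InnerProductSpace ℝ V] [FiniteDimensional ℝ V]
    (ω : LinearMap.BilinForm ℝ V) (hωalt : ω.IsAlt) (hω : ω.Nondegenerate)
    -- the compact Lie group and its two homomorphisms
    {E : Type*} [NormedAddCommGroup E] [NormedSpace ℝ E] {M : Type*} [TopologicalSpace M]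
    (I : ModelWithCorners ℝ E M)
    {Γ : Type*} [Group Γ] [TopologicalSpace Γ] [ChartedSpace M Γ]
    [LieGroup I ((⊤ : ℕ∞) : WithTop ℕ∞) Γ] [CompactSpace Γ]
    (σ₁ σ₂ : Γ →* ℤˣ)
    -- the linear action on `V`: semisymplectic, and orthogonal for the inner product of `V`
    -- (the one that defines transposes)
    (ρ : Γ →* GLin V) (hρc : Continuous fun p : Γ × V => (ρ p.1 : V →L[ℝ] V) p.2)
    (hρo : IsOrthogonal ρ) (hρω : IsSemisymplectic ω ρ σ₁)
    -- the Hamiltonian function and its equivariant vector field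
    (H : V → ℝ) (hH : ContDiff ℝ ((⊤ : ℕ∞) : WithTop ℕ∞) H) (hH0 : H 0 = 0)
    (X : V → V) (hXH : X = hamVF ω hω H) (hX0 : X 0 = 0) (hX : IsEquivariant ρ σ₂ X)
    -- the group `S`, which acts symplectically
    (hS : IsSymplecticAction ω (groupS (fderiv ℝ X 0)).subtype)
    (r : ℕ) :
    ∃ P : ℕ → V → ℝ,
      -- `Kᵏ` lies in the space `𝒫ᵏ` of `σ̃₁σ̃₂`-invariants of `S ⋊ Γ`
      (∀ k ∈ Finset.Icc 3 r,
        P k ∈ homPolyInv (semiAction ρ (fderiv ℝ X 0) (mem_normalizer_groupS hρo hX))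
          (tildeChar ρ (fderiv ℝ X 0) (mem_normalizer_groupS hρo hX) σ₁ *
            tildeChar ρ (fderiv ℝ X 0) (mem_normalizer_groupS hρo hX) σ₂) k) ∧
      -- `K = H² + K³ + ⋯ + Kʳ` is a normal form of `H` up to order `r`, with `𝒟ᵏ = 𝒫ᵏ(S)`
      IsNormalForm ω hω (homPolyInv (groupS (fderiv ℝ X 0)).subtype 1) H r
        (quadPart H + ∑ k ∈ Finset.Icc 3 r, P k) ∧
      -- `X_K` is a normal form of `X` up to order `r - 1`
      IsNormalFormVF ω hω (homPolyInv (groupS (fderiv ℝ X 0)).subtype 1) H X r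
        (hamVF ω hω (quadPart H + ∑ k ∈ Finset.Icc 3 r, P k)) ∧
      -- `X_K` has the symmetries and reversing symmetries of `X`
      IsEquivariant ρ σ₂ (hamVF ω hω (quadPart H + ∑ k ∈ Finset.Icc 3 r, P k)) := by
  subst hXH
  set L := fderiv ℝ (hamVF ω hω H) 0 with hL
  -- For `r < 2` the truncated `r - 2` is `0`: the sum is still empty, and the order `r - 2 + 3` is
  -- at least `r + 1` in all cases.
  obtain ⟨P, U, ξ, hP, hξ, -, hO⟩ := exists_semiinvariant_normalForm hωalt hω hρo hρω hH hH0
    hX0 hX (r - 2)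
  have hIcc : Finset.Icc 3 (r - 2 + 2) = Finset.Icc 3 r := by
    ext k
    simp only [Finset.mem_Icc]
    omega
  rw [hIcc] at hO
  set K := quadPart H + ∑ k ∈ Finset.Icc 3 r, P k with hK
  have hPd : ∀ k, Differentiable ℝ (P k) := fun k => differentiable_of_mem_homPoly (hP k).1.1
  have hQd : Differentiable ℝ (quadPart H) :=
    differentiable_of_mem_homPoly (quadPart_mem_homPoly H)
  have hKs : ContDiff ℝ ((⊤ : ℕ∞) : WithTop ℕ∞) K :=
    contDiff_quadPart_add_sum H _ fun k => (hP k).1.1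
  have hXK : hamVF ω hω K = fun y => L y + ∑ k ∈ Finset.Icc 3 r, hamVF ω hω (P k) y := by
    funext y
    rw [hL, ← hamVF_quadPart hH.contDiffAt]
    simp only [hamVF_eq_dualToVec]
    rw [← map_sum, ← map_add, hK, fderiv_add (hQd y) (DifferentiableAt.sum fun k _ => hPd k y),
      fderiv_sum fun k _ => hPd k y]
  have hcompl : ∀ k ∈ Finset.Icc 3 r,
      IsComplementAd ω hω H k (homPolyInv (groupS L).subtype 1 k) := fun k _ =>
    isComplementAd_groupS hH.contDiffAt k
  have hHξ : ContDiffAt ℝ ((⊤ : ℕ∞) : WithTop ℕ∞) (H ∘ ξ) 0 :=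
    hH.contDiffAt.comp 0 (hξ.contDiffAt hξ.zero_mem)
  refine ⟨P, fun k _ => ⟨(hP k).1.1, fun g x => ?_⟩,
    ⟨hcompl, ⟨P, fun k _ => (hP k).1, rfl⟩, U, ξ, hξ,
      hO.trans (norm_pow_isBigO_norm_pow (by omega))⟩,
    ⟨hcompl, ⟨P, fun k _ => (hP k).1, hXK⟩, U, ξ, hξ, hamVF ω hω (H ∘ ξ), fun y hy =>
      hξ.fderiv_hamVF_comp hω (hH.differentiable (by simp)) hy, ?_⟩, fun g x => ?_⟩
  · have h1 : P k (((g.left : GLin V) : V →L[ℝ] V) ((ρ g.right : V →L[ℝ] V) x)) =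
        P k ((ρ g.right : V →L[ℝ] V) x) := by
      simpa using (hP k).1.2 g.left ((ρ g.right : V →L[ℝ] V) x)
    exact h1.trans ((hP k).2 g.right x)
  -- The transformed field is `Z = X_{H ∘ ξ}`, for the same `ξ`; passing from functions to their
  -- vector fields costs one order.
  · exact (hamVF_sub_hamVF_isBigO hω hHξ hKs.contDiffAt hO).trans
      (norm_pow_isBigO_norm_pow (by omega))
  · have hKinv : ∀ x, K ((ρ g : V →L[ℝ] V) x) = (σ₁ g * σ₂ g) • K x := fun x => by
      simp only [hK, Pi.add_apply, Finset.sum_apply, smul_add, Finset.smul_sum, (hP _).2,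
        quadPart_semiinvariant hρω hH.contDiffAt hX]
    rw [hamVF_apply_of_semiinvariant hρω hKinv, ← mul_assoc, ← sq, Int.units_sq, one_mul]
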